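/- Let $n \geq 2$ and let $F_n$ be the free group on $x_1, \ldots, x_n$. Let $$\mathbb{Q}[t] = \mathbb{Q}[t_{i_1 \cdots i_l} \mid 1 \leq l \leq 3,\ 1 \leq i_1 < \cdots < i_l \leq n]$$ be the polynomial ring in $n + \binom{n}{2} + \binom{n}{3}$ indeterminates, and let $\pi_{\mathbb{Q}}$ be the $\mathbb{Q}$-algebra homomorphism from $\mathbb{Q}[t]$ to the algebra of all functions $\mathrm{Hom}(F_n, \mathrm{SL}(2,\mathbb{C})) \to \mathbb{C}$ that sends $t_{i_1 \cdots i_l}$ to the function $\rho \mapsto \mathrm{tr}\,\rho(x_{i_1} \cdots x_{i_l})$. Put $I_{\mathbb{Q}} = \mathrm{Ker}\,\pi_{\mathbb{Q}}$ and $t'_{i_1 \cdots i_l} = t_{i_1 \cdots i_l} - 2$, and let $J$ be the ideal of $\mathbb{Q}[t]/I_{\mathbb{Q}}$ generated by the classes of all the $t'_{i_1 \cdots i_l}$. For $k \geq 1$ let $\mathrm{gr}^k(J) = J^k/J^{k+1}$. Define subsets of $\mathbb{Q}[t]$ by $$T = \{ t'_i \mid 1 \leq i \leq n \} \cup \{ t'_{ij}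 \mid 1 \leq i < j \leq n \} \cup \{ t'_{ijk} \mid 1 \leq i < j < k \leq n \}$$ and $$\begin{aligned} S = {} & \{ t'_i t'_j \mid 1 \leq i \leq j \leq n \} \cup \{ t'_i t'_{ab} \mid 1 \leq i \leq n,\ 1 \leq a < b \leq n \} \\ & \cup \{ t'_i t'_{abc} \mid 1 \leq i \leq n,\ 1 \leq a < b < c \leq n \} \\ & \cup \{ t'_{ij} t'_{ab} \mid 1 \leq i < j \leq n,\ 1 \leq a < b \leq n,\ (i,j) \leq (a,b) \} \\ & \cup \{ t'_{ab} t'_{abc},\ t'_{ac} t'_{abc},\ t'_{bc} t'_{abc} \mid 1 \leq a < b < c \leq n \} \\ & \cup \{ t'_{ia} t'_{abc},\ t'_{ib} t'_{abc},\ t'_{ic} t'_{abc},\ t'_{ia} t'_{ibc},\ t'_{ab} t'_{iac},\ t'_{ab} t'_{ibc},\ t'_{ac} t'_{ibc},\ t'_{ib} t'_{iac} \mid 1 \leq i < a < b < c \leq n \} \\ & \cup \{ t'_{ja} t'_{ibc},\ t'_{jb} t'_{iac},\ t'_{jc} t'_{iab},\ t'_{ab} t'_{ijc},\ t'_{ac}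 t'_{ijb},\ t'_{bc} t'_{ija} \mid 1 \leq i < j < a < b < c \leq n \}, \end{aligned}$$ where pairs are compared lexicographically. Let $J_0$ be the ideal of $\mathbb{Q}[t]$ generated by $T$. Then: 1. $I_{\mathbb{Q}} \subset J_0^2$; 2. the classes of the elements of $T$ lie in $J$ and form a $\mathbb{Q}$-basis of $\mathrm{gr}^1(J)$ (distinct elements of $T$ having distinct classes); 3. the classes of the elements of $S$ lie in $J^2$ and form a $\mathbb{Q}$-basis of $\mathrm{gr}^2(J)$ (distinct elements of $S$ having distinct classes). -/

import Mathlib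

namespace Fricke

open Matrix

/-- Index set of the indeterminates `t_i`, `t_{ij}` (`i < j`), `t_{ijk}` (`i < j < k`). -/
inductive Index (n : ℕ) : Type
  | one (i : Fin n) : Index n
  | two (i j : Fin n) (hij : i < j) : Index n
  | three (i j k : Fin n) (hij : i < j) (hjk : j < k) : Index n

/-- The product `x_{i_1} ⋯ x_{i_l}` attached to an index `i_1 < ⋯ < i_l`. -/
def Index.word {n : ℕ} {G : Type*} [Group G] (x : Fin n → G) : Index n → G
  | .one i => x i
  | .two i j _ => x i * x j
  | .three i j k _ _ => x i * x j * x k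

/-- The set `R(G) = Hom(G, SL(2, ℂ))`. -/
abbrev Rep (G : Type*) [Group G] : Type _ := G →* SpecialLinearGroup (Fin 2) ℂ

/-- The Fricke character `tr g`, a complex-valued function on `R(G)`. -/
noncomputable def tr {G : Type*} [Group G] (g : G) : Rep G → ℂ :=
  fun ρ => Matrix.trace (ρ g : Matrix (Fin 2) (Fin 2) ℂ)

/-- The polynomial ring `ℚ[t]` in the `n + C(n,2) + C(n,3)` indeterminates `t_{i_1 ⋯ i_l}`. -/
abbrev Poly (n : ℕ) : Type := MvPolynomial (Index n) ℚ

/-- The homomorphism `π_ℚ` from `ℚ[t]` to the functions on `R(G)`,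
with `t_{i_1 ⋯ i_l} ↦ tr (x_{i_1} ⋯ x_{i_l})`. -/
noncomputable def piQ {n : ℕ} {G : Type*} [Group G] (x : Fin n → G) :
    Poly n →ₐ[ℚ] (Rep G → ℂ) :=
  MvPolynomial.aeval fun s => tr (s.word x)

/-- The ideal `I_ℚ = Ker π_ℚ`. -/
noncomputable def IQ {n : ℕ} {G : Type*} [Group G] (x : Fin n → G) : Ideal (Poly n) :=
  RingHom.ker (piQ x)

/-- The ring of Fricke characters `ℚ[t] / I_ℚ`. -/
abbrev FrickeRing {n : ℕ} {G : Type*} [Group G] (x : Fin n → G) : Type :=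
  Poly n ⧸ IQ x

/-- The coset of a polynomial in `ℚ[t] / I_ℚ`. -/
noncomputable abbrev cls {n : ℕ} {G : Type*} [Group G] (x : Fin n → G) (p : Poly n) :
    FrickeRing x :=
  Ideal.Quotient.mk (IQ x) p

/-- `t'_s = t_s - 2` in `ℚ[t]`. -/
noncomputable def t' {n : ℕ} (s : Index n) : Poly n := MvPolynomial.X s - 2

/-- `t'_i`. -/
noncomputable abbrev t₁ {n : ℕ} (i : Fin n) : Poly n := t' (.one i)

/-- `t'_{ij}` for `i < j`. -/
noncomputable abbrev t₂ {n : ℕ} (i j : Fin n) (hij : i < j) : Poly n := t' (.two i j hij)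

/-- `t'_{ijk}` for `i < j < k`. -/
noncomputable abbrev t₃ {n : ℕ} (i j k : Fin n) (hij : i < j) (hjk : j < k) : Poly n :=
  t' (.three i j k hij hjk)

/-- The ideal `J` of `ℚ[t] / I_ℚ` generated by the cosets of all `t'_s`. -/
noncomputable def J {n : ℕ} {G : Type*} [Group G] (x : Fin n → G) : Ideal (FrickeRing x) :=
  Ideal.span (Set.range fun s : Index n => cls x (t' s))

/-- The graded quotient `gr^k(J) = J^k / J^{k+1}`. -/
abbrev Gr {n : ℕ} {G : Type*} [Group G] (x : Fin n → G) (k : ℕ) : Type :=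
  ↥(J x ^ k) ⧸ (J x ^ (k + 1)).submoduleOf (J x ^ k)

/-- The class in `gr^k(J)` of an element of `J^k`. -/
noncomputable def grMk {n : ℕ} {G : Type*} [Group G] (x : Fin n → G) (k : ℕ)
    (a : FrickeRing x) (ha : a ∈ J x ^ k) : Gr x k :=
  Submodule.Quotient.mk ⟨a, ha⟩

/-- A set `B` of polynomials maps into `J^k`, and the family of the resulting classes, indexed
by the elements of `B`, is a `ℚ`-basis of `gr^k(J)` (so distinct elements of `B` have distinct
classes). -/
def IsGrBasis {n : ℕ} {G : Type*} [Group G] (x : Fin n → G) (k : ℕ) (B : Set (Poly n)) : Prop :=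
  ∃ b : Module.Basis B ℚ (Gr x k),
    ∀ p : B, ∃ hp : cls x (p : Poly n) ∈ J x ^ k, b p = grMk x k (cls x (p : Poly n)) hp

/-- The set `T` of all `t'_i`, `t'_{ij}`, `t'_{ijk}`. -/
def T (n : ℕ) : Set (Poly n) :=
  {p | ∃ i : Fin n, p = t₁ i} ∪
  {p | ∃ (i j : Fin n) (hij : i < j), p = t₂ i j hij} ∪
  {p | ∃ (i j k : Fin n) (hij : i < j) (hjk : j < k), p = t₃ i j k hij hjk}

/-- The ideal `J_0` of `ℚ[t]` generated by `T`. -/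
noncomputable def J₀ (n : ℕ) : Ideal (Poly n) := Ideal.span (T n)

/-- The first part of `S`. Pairs are compared lexicographically. -/
def S₁ (n : ℕ) : Set (Poly n) :=
  {p | ∃ i j : Fin n, i ≤ j ∧ p = t₁ i * t₁ j} ∪
  {p | ∃ (i a b : Fin n) (hab : a < b), p = t₁ i * t₂ a b hab} ∪
  {p | ∃ (i a b c : Fin n) (hab : a < b) (hbc : b < c), p = t₁ i * t₃ a b c hab hbc} ∪
  {p | ∃ (i j a b : Fin n) (hij : i < j) (hab : a < b),
      toLex (i, j) ≤ toLex (a, b) ∧ p = t₂ i j hij * t₂ a b hab}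

/-- The second part of `S`. -/
def S₂ (n : ℕ) : Set (Poly n) :=
  {p | ∃ (a b c : Fin n) (hab : a < b) (hbc : b < c),
      p = t₂ a b hab * t₃ a b c hab hbc ∨
      p = t₂ a c (hab.trans hbc) * t₃ a b c hab hbc ∨
      p = t₂ b c hbc * t₃ a b c hab hbc} ∪
  {p | ∃ (i a b c : Fin n) (hia : i < a) (hab : a < b) (hbc : b < c),
      p = t₂ i a hia * t₃ a b c hab hbc ∨
      p = t₂ i b (hia.trans hab) * t₃ a b c hab hbc ∨
      p = t₂ i c (hia.trans (hab.trans hbc)) * t₃ a b c hab hbc ∨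
      p = t₂ i a hia * t₃ i b c (hia.trans hab) hbc ∨
      p = t₂ a b hab * t₃ i a c hia (hab.trans hbc) ∨
      p = t₂ a b hab * t₃ i b c (hia.trans hab) hbc ∨
      p = t₂ a c (hab.trans hbc) * t₃ i b c (hia.trans hab) hbc ∨
      p = t₂ i b (hia.trans hab) * t₃ i a c hia (hab.trans hbc)} ∪
  {p | ∃ (i j a b c : Fin n) (hij : i < j) (hja : j < a) (hab : a < b) (hbc : b < c),
      p = t₂ j a hja * t₃ i b c (hij.trans (hja.trans hab)) hbc ∨
      p = t₂ j b (hja.trans hab) * t₃ i a c (hij.trans hja) (hab.trans hbc) ∨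
      p = t₂ j c (hja.trans (hab.trans hbc)) * t₃ i a b (hij.trans hja) hab ∨
      p = t₂ a b hab * t₃ i j c hij (hja.trans (hab.trans hbc)) ∨
      p = t₂ a c (hab.trans hbc) * t₃ i j b hij (hja.trans hab) ∨
      p = t₂ b c hbc * t₃ i j a hij hja}

/-- The set `S` of quadratic monomials in the `t'`. -/
def S (n : ℕ) : Set (Poly n) := S₁ n ∪ S₂ n

end Fricke

/-!
Write `ρ (x i) = wᵢ + Yᵢ` with `wᵢ` scalar and `Yᵢ` traceless. The dot products `tr (Yᵢ Yⱼ)` and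
the triple products `tr (Yᵢ Yⱼ Yₖ)` are values of polynomials in the `t'` which modulo `J₀ ^ 2`
have the same `ℚ`-span as the `t'`. Two identities for vectors in three-space show that `S` spans:
a product of two triple products is a Gram determinant, hence lies in `J₀ ^ 3` modulo `I_ℚ`, and
the four-term relation obtained by expanding the vanishing alternating sum of
`tr (Yₘ Yᵢ) tr (Yⱼ Yₖ Yₗ)` over `i`, `j`, `k`, `l` expresses each monomial `t'_{pq} t'_{abc}`
outside `S` through monomials in `S`.

For independence, let `Y` be arbitrary and send the `i`-th generator to `√(1 - z² det Yᵢ) + z Yᵢ`.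
On these representations `J₀ ^ k + I_ℚ` is `O(z ^ (2 k))`, whereas `t'_s` corrected by an element
of `J₀ ^ 2` takes the value `z² q_s + z³ m_s` with `q_s` a quadratic form and `m_s` a `3 × 3` minor
in the entries of `Y`. Comparing the coefficients of the two lowest powers of `z` gives identities
between forms in `Y`. The lowest one is handled by polarization. In degree two, the other one says
that the coefficients of the `t'_s t'_{abc}` give an element of `Sym² V ⊗ Λ³ V` killed by the
Koszul differential; vanishing at the monomials outside `S` forces such an element to be zero.
-/

namespace Fricke

open Matrix MvPolynomial

section Generators

variable {n : ℕ}

theorem T_eq_range : T n = Set.range t' := by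
  ext p
  constructor
  · rintro ((⟨i, rfl⟩ | ⟨i, j, hij, rfl⟩) | ⟨i, j, k, hij, hjk, rfl⟩)
    exacts [⟨_, rfl⟩, ⟨_, rfl⟩, ⟨_, rfl⟩]
  · rintro ⟨i | ⟨i, j, hij⟩ | ⟨i, j, k, hij, hjk⟩, rfl⟩
    exacts [.inl (.inl ⟨_, rfl⟩), .inl (.inr ⟨_, _, _, rfl⟩), .inr ⟨_, _, _, _, _, rfl⟩]

theorem J₀_eq_span_range : J₀ n = Ideal.span (Set.range t') := by
  rw [J₀, T_eq_range]

theorem t'_mem_J₀ (s : Index n) : t' s ∈ J₀ n := by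
  rw [J₀_eq_span_range]
  exact Ideal.subset_span ⟨s, rfl⟩

theorem t'_mul_t'_mem_J₀_sq (s r : Index n) : t' s * t' r ∈ J₀ n ^ 2 :=
  pow_two (J₀ n) ▸ Ideal.mul_mem_mul (t'_mem_J₀ s) (t'_mem_J₀ r)

theorem sub_C_eval_two_mem_J₀ (p : Poly n) : p - C (eval (fun _ => 2) p) ∈ J₀ n := by
  rw [← Ideal.Quotient.eq]
  have hom_eq : Ideal.Quotient.mk (J₀ n) =
      ((Ideal.Quotient.mk (J₀ n)).comp C).comp (eval fun _ => (2 : ℚ)) := by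
    refine ringHom_ext (fun a => by simp) fun s => ?_
    simpa [t', Ideal.Quotient.eq, map_ofNat C] using t'_mem_J₀ s
  exact RingHom.congr_fun hom_eq p

theorem mem_span_rat_sup_J₀_mul {B : Set (Poly n)} {p : Poly n} (hp : p ∈ Ideal.span B) :
    p ∈ Submodule.span ℚ B ⊔ (J₀ n * Ideal.span B).restrictScalars ℚ := by
  induction hp using Submodule.span_induction with
  | mem p hp => exact Submodule.mem_sup_left (Submodule.subset_span hp)
  | zero => exact zero_mem _
  | add p r _ _ hp hr => exact add_mem hp hr
  | smul f p hpB hp =>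
    have split : f • p = eval (fun _ => 2) f • p + (f - C (eval (fun _ => 2) f)) * p := by
      rw [smul_eq_C_mul, smul_eq_mul]; ring
    rw [split]
    exact add_mem (Submodule.smul_mem _ _ hp)
      (Submodule.mem_sup_right (Ideal.mul_mem_mul (sub_C_eval_two_mem_J₀ f) hpB))

theorem algebraicIndependent_t' : AlgebraicIndependent ℚ (t' : Index n → Poly n) := by
  let untranslate : Poly n →ₐ[ℚ] Poly n := aeval fun s => X s + 2
  have left_inverse : untranslate.comp (aeval t') = AlgHom.id ℚ (Poly n) := by
    refine algHom_ext fun s => ?_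
    rw [AlgHom.comp_apply, aeval_X, t', map_sub, aeval_X, map_ofNat, add_sub_cancel_right,
      AlgHom.id_apply]
  exact Function.LeftInverse.injective (g := untranslate) fun p => AlgHom.congr_fun left_inverse p

theorem linearIndependent_prod_t' :
    LinearIndependent ℚ fun m : Index n →₀ ℕ => m.prod fun s k => (t' s : Poly n) ^ k := by
  have prod_eq : (fun m : Index n →₀ ℕ => m.prod fun s k => (t' s : Poly n) ^ k) =
      (aeval t').toLinearMap ∘ basisMonomials (Index n) ℚ := by
    ext1 m
    rw [Function.comp_apply, coe_basisMonomials, AlgHom.toLinearMap_apply, aeval_monomial, map_one,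
      one_mul]
  rw [prod_eq]
  exact (basisMonomials (Index n) ℚ).linearIndependent.map' _
    (LinearMap.ker_eq_bot.2 algebraicIndependent_t')

theorem t'_mul_t'_eq_prod (s r : Index n) :
    t' s * t' r =
      (Finsupp.single s 1 + Finsupp.single r 1).prod fun s k => (t' s : Poly n) ^ k := by
  rw [Finsupp.prod_add_index' (fun _ => pow_zero _) fun _ _ _ => pow_add _ _ _]
  simp

theorem t'_mul_t'_eq_iff {s r u v : Index n} :
    t' s * t' r = t' u * t' v ↔ s = u ∧ r = v ∨ s = v ∧ r = u := by
  rw [t'_mul_t'_eq_prod, t'_mul_t'_eq_prod, linearIndependent_prod_t'.injective.eq_iff,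
    Finsupp.single_add_single_eq_single_add_single one_ne_zero one_ne_zero]
  simp

theorem linearIndepOn_T : LinearIndepOn ℚ id (T n) := by
  refine linearIndependent_prod_t'.linearIndepOn_id.mono ?_
  rw [T_eq_range]
  rintro _ ⟨s, rfl⟩
  exact ⟨Finsupp.single s 1, by simp⟩

theorem exists_of_mem_S {p : Poly n} (hp : p ∈ S n) : ∃ s r : Index n, p = t' s * t' r := by
  rcases hp with (((⟨_, _, _, e⟩ | ⟨_, _, _, _, e⟩) | ⟨_, _, _, _, _, _, e⟩) |
    ⟨_, _, _, _, _, _, _, e⟩) | ((⟨_, _, _, _, _, e | e | e⟩ |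
    ⟨_, _, _, _, _, _, _, e | e | e | e | e | e | e | e⟩) |
    ⟨_, _, _, _, _, _, _, _, _, e | e | e | e | e | e⟩)
  all_goals exact ⟨_, _, e⟩

theorem linearIndepOn_S : LinearIndepOn ℚ id (S n) := by
  refine linearIndependent_prod_t'.linearIndepOn_id.mono fun p hp => ?_
  obtain ⟨s, r, rfl⟩ := exists_of_mem_S hp
  exact ⟨_, (t'_mul_t'_eq_prod s r).symm⟩

end Generators

section GradedQuotient

variable {n : ℕ} {G : Type*} [Group G] (x : Fin n → G) (k : ℕ)

theorem J_eq_map : J x = (J₀ n).map (Ideal.Quotient.mk (IQ x)) := by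
  rw [J, J₀_eq_span_range, Ideal.map_span, ← Set.range_comp]
  rfl

theorem J_pow_eq_map : J x ^ k = (J₀ n ^ k).map (Ideal.Quotient.mk (IQ x)) := by
  rw [J_eq_map, Ideal.map_pow]

theorem cls_mem_J_pow_iff {p : Poly n} : cls x p ∈ J x ^ k ↔ p ∈ J₀ n ^ k ⊔ IQ x := by
  rw [J_pow_eq_map, ← Ideal.mem_comap,
    Ideal.comap_map_of_surjective' _ Ideal.Quotient.mk_surjective, Ideal.mk_ker]

/-- The map `J₀ ^ k → gr^k(J)` sending a polynomial to the class of its coset. -/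
noncomputable def toGr : (J₀ n ^ k).restrictScalars ℚ →ₗ[ℚ] Gr x k where
  toFun p := grMk x k (cls x p) ((cls_mem_J_pow_iff x k).2 (Ideal.mem_sup_left p.2))
  map_add' _ _ := rfl
  map_smul' _ _ := rfl

variable {x k}

theorem toGr_eq_zero_iff {p : (J₀ n ^ k).restrictScalars ℚ} :
    toGr x k p = 0 ↔ (p : Poly n) ∈ J₀ n ^ (k + 1) ⊔ IQ x :=
  (Submodule.Quotient.mk_eq_zero _).trans (cls_mem_J_pow_iff x (k + 1))

theorem toGr_surjective : Function.Surjective (toGr x k) := by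
  intro y
  obtain ⟨⟨a, ha⟩, rfl⟩ := Submodule.Quotient.mk_surjective _ y
  have ha' := ha
  rw [J_pow_eq_map, Ideal.mem_map_iff_of_surjective _ Ideal.Quotient.mk_surjective] at ha'
  obtain ⟨p, hp, rfl⟩ := ha'
  exact ⟨⟨p, hp⟩, rfl⟩

theorem isGrBasis_of_disjoint {B : Set (Poly n)} (hB : ∀ p ∈ B, p ∈ J₀ n ^ k)
    (hspan : ∀ p ∈ J₀ n ^ k,
      p ∈ Submodule.span ℚ B ⊔ (J₀ n ^ (k + 1) ⊔ IQ x).restrictScalars ℚ)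
    (hindep : LinearIndepOn ℚ id B)
    (hdisj : Disjoint (Submodule.span ℚ B) ((J₀ n ^ (k + 1) ⊔ IQ x).restrictScalars ℚ)) :
    IsGrBasis x k B := by
  let w : B → (J₀ n ^ k).restrictScalars ℚ := fun p => ⟨p, hB p p.2⟩
  have mem_span_range_w (v : (J₀ n ^ k).restrictScalars ℚ) :
      v ∈ Submodule.span ℚ (Set.range w) ↔ (v : Poly n) ∈ Submodule.span ℚ B := by
    have map_span : (Submodule.span ℚ (Set.range w)).map (Submodule.subtype _) =
        Submodule.span ℚ B := by
      rw [Submodule.map_span, ← Set.range_comp]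
      exact congrArg (Submodule.span ℚ) Subtype.range_coe
    rw [← map_span]
    exact (Submodule.subtype_injective _).mem_set_image.symm
  have indep : LinearIndependent ℚ (toGr x k ∘ w) := by
    have indep_w : LinearIndependent ℚ w :=
      .of_comp ((J₀ n ^ k).restrictScalars ℚ).subtype hindep
    refine indep_w.map (Submodule.disjoint_def.2 fun v hv hv0 => Subtype.ext ?_)
    exact Submodule.disjoint_def.1 hdisj v ((mem_span_range_w v).1 hv) (toGr_eq_zero_iff.1 hv0)
  have span_eq_top : ⊤ ≤ Submodule.span ℚ (Set.range (toGr x k ∘ w)) := by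
    rintro y -
    obtain ⟨p, rfl⟩ := toGr_surjective y
    obtain ⟨v, hv, r, hr, hp⟩ := Submodule.mem_sup.1 (hspan p p.2)
    have hvk : v ∈ J₀ n ^ k :=
      (Submodule.span_le (p := (J₀ n ^ k).restrictScalars ℚ)).2 hB hv
    have toGr_eq : toGr x k p = toGr x k ⟨v, hvk⟩ := by
      rw [← sub_eq_zero, ← map_sub, toGr_eq_zero_iff]
      rwa [AddSubgroupClass.coe_sub, ← hp, add_sub_cancel_left]
    rw [toGr_eq, Set.range_comp, ← Submodule.map_span]
    exact Submodule.mem_map_of_mem ((mem_span_range_w _).2 hv)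
  exact ⟨.mk indep span_eq_top, fun p => ⟨(cls_mem_J_pow_iff x k).2
    (Ideal.mem_sup_left (hB p p.2)), Module.Basis.mk_apply _ _ _⟩⟩

end GradedQuotient

section TracelessCoordinates

variable {ι K : Type*} [CommRing K]

/-- The trace form `tr (Yᵢ Yⱼ)` of the traceless matrices `Yᵢ = !![P i, Q i; R i, -P i]`. -/
def dot (P Q R : ι → K) (i j : ι) : K :=
  2 * P i * P j + Q i * R j + R i * Q j

/-- The alternating form `tr (Yᵢ Yⱼ Yₖ)` of the traceless matrices `Yᵢ = !![P i, Q i; R i, -P i]`,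
which is the determinant of their coordinates. -/
def triple (P Q R : ι → K) (i j k : ι) : K :=
  P i * (Q j * R k - R j * Q k) - Q i * (P j * R k - R j * P k) + R i * (P j * Q k - Q j * P k)

variable (P Q R : ι → K)

theorem dot_comm (i j : ι) : dot P Q R i j = dot P Q R j i := by
  simp only [dot]; ring

theorem two_mul_triple_mul_triple (i j k a b c : ι) :
    2 * (triple P Q R i j k * triple P Q R a b c) =
      -(dot P Q R i a * (dot P Q R j b * dot P Q R k c - dot P Q R j c * dot P Q R k b)
        - dot P Q R i b * (dot P Q R j a * dot P Q R k c - dot P Q R j c * dot P Q R k a)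
        + dot P Q R i c * (dot P Q R j a * dot P Q R k b - dot P Q R j b * dot P Q R k a)) := by
  simp only [dot, triple]; ring

theorem dot_mul_triple_relation (m i j k l : ι) :
    dot P Q R m i * triple P Q R j k l - dot P Q R m j * triple P Q R i k l
      + dot P Q R m k * triple P Q R i j l - dot P Q R m l * triple P Q R i j k = 0 := by
  simp only [dot, triple]; ring

end TracelessCoordinates

section InvariantPolynomials

variable {n : ℕ}

/-- The family `t'_{ij}` extended symmetrically to all pairs `i`, `j`, with the value `0` on the
diagonal. -/
noncomputable def tSym (i j : Fin n) : Poly n :=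
  if h : i < j then t₂ i j h else if h : j < i then t₂ j i h else 0

/-- The polynomial evaluating to `tr (Yᵢ Yⱼ)`, for `Yᵢ` the traceless part of `ρ (x i)`. -/
noncomputable def dotPoly (i j : Fin n) : Poly n :=
  if i = j then 2 * t₁ i + C (1 / 2) * t₁ i ^ 2
  else tSym i j - t₁ i - t₁ j - C (1 / 2) * (t₁ i * t₁ j)

/-- The polynomial evaluating to `tr (Yᵢ Yⱼ Yₖ)`, for `Yᵢ` the traceless part of `ρ (x i)`. -/
noncomputable def triplePoly (i j k : Fin n) (hij : i < j) (hjk : j < k) : Poly n :=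
  t₃ i j k hij hjk - t₂ i j hij - t₂ i k (hij.trans hjk) - t₂ j k hjk
    + t₁ i * (1 - C (1 / 2) * t₂ j k hjk + t₁ j + C (1 / 2) * (t₁ j * t₁ k))
    + t₁ j * (1 - C (1 / 2) * t₂ i k (hij.trans hjk) + t₁ k)
    + t₁ k * (1 - C (1 / 2) * t₂ i j hij + t₁ i)

theorem tSym_comm (i j : Fin n) : tSym i j = tSym j i := by
  rcases lt_trichotomy i j with h | rfl | h
  · simp [tSym, h, h.asymm]
  · rfl
  · simp [tSym, h, h.asymm]

theorem tSym_of_lt {i j : Fin n} (h : i < j) : tSym i j = t₂ i j h :=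
  dif_pos h

theorem tSym_of_gt {i j : Fin n} (h : j < i) : tSym i j = t₂ j i h := by
  rw [tSym_comm, tSym_of_lt]

theorem tSym_self (i : Fin n) : tSym i i = 0 := by
  simp [tSym]

theorem tSym_mem_J₀ (i j : Fin n) : tSym i j ∈ J₀ n := by
  unfold tSym
  split_ifs
  exacts [t'_mem_J₀ _, t'_mem_J₀ _, zero_mem _]

theorem dotPoly_comm (i j : Fin n) : dotPoly i j = dotPoly j i := by
  by_cases h : i = j
  · rw [h]
  · rw [dotPoly, dotPoly, if_neg h, if_neg (Ne.symm h), tSym_comm]; ring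

section Evaluation

variable {G : Type*} [Group G] (x : Fin n → G) (ρ : Rep G)

theorem coe_rep_mul (g h : G) : (ρ (g * h) : Matrix (Fin 2) (Fin 2) ℂ) = ρ g * ρ h :=
  congrArg Subtype.val (map_mul ρ g h)

theorem piQ_C_apply (a : ℚ) : piQ x (C a) ρ = a := by
  simp [piQ]

theorem piQ_t'_apply (s : Index n) :
    piQ x (t' s) ρ = trace (ρ (s.word x) : Matrix (Fin 2) (Fin 2) ℂ) - 2 := by
  rw [t', map_sub, Pi.sub_apply, map_ofNat]
  simp [piQ, tr]

theorem mem_IQ_iff {p : Poly n} : p ∈ IQ x ↔ ∀ ρ : Rep G, piQ x p ρ = 0 :=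
  RingHom.mem_ker.trans funext_iff

theorem IQ_le_J₀ : IQ x ≤ J₀ n := by
  intro p hp
  have piQ_trivial : (Pi.evalAlgHom ℚ _ 1).comp (piQ x) =
      (Algebra.ofId ℚ ℂ).comp (aeval fun _ => 2) := by
    refine algHom_ext fun s => ?_
    simp [piQ, tr]
  have eval_eq_zero : eval (fun _ => (2 : ℚ)) p = 0 := by
    have h := (AlgHom.congr_fun piQ_trivial p).symm.trans ((mem_IQ_iff x).1 hp 1)
    simpa [Algebra.ofId_apply] using h
  simpa [eval_eq_zero] using sub_C_eval_two_mem_J₀ p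

/-- The `P`-coordinates of the traceless parts `!![P i, Q i; R i, -P i]` of the `ρ (x i)`. -/
noncomputable def coordP (i : Fin n) : ℂ := (ρ (x i) 0 0 - ρ (x i) 1 1) / 2

/-- The `Q`-coordinates of the traceless parts `!![P i, Q i; R i, -P i]` of the `ρ (x i)`. -/
noncomputable def coordQ (i : Fin n) : ℂ := ρ (x i) 0 1

/-- The `R`-coordinates of the traceless parts `!![P i, Q i; R i, -P i]` of the `ρ (x i)`. -/
noncomputable def coordR (i : Fin n) : ℂ := ρ (x i) 1 0

theorem piQ_dotPoly_apply (i j : Fin n) :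
    piQ x (dotPoly i j) ρ = dot (coordP x ρ) (coordQ x ρ) (coordR x ρ) i j := by
  have of_lt {i j : Fin n} (h : i < j) :
      piQ x (dotPoly i j) ρ = dot (coordP x ρ) (coordQ x ρ) (coordR x ρ) i j := by
    simp only [dotPoly, if_neg h.ne, tSym_of_lt h, map_sub, map_mul (piQ x), Pi.sub_apply,
      Pi.mul_apply, piQ_t'_apply, piQ_C_apply, dot, coordP, coordQ, coordR, Index.word,
      coe_rep_mul, trace_fin_two, mul_apply, Fin.sum_univ_two]
    push_cast
    ring
  rcases lt_trichotomy i j with h | rfl | h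
  · exact of_lt h
  · have det_eq_one := (ρ (x i)).det_coe
    rw [det_fin_two] at det_eq_one
    simp only [dotPoly, ↓reduceIte, map_add, map_mul, map_pow, map_ofNat, Pi.add_apply,
      Pi.mul_apply, Pi.pow_apply, Pi.ofNat_apply, piQ_t'_apply, piQ_C_apply, dot, coordP, coordQ,
      coordR, Index.word, trace_fin_two]
    push_cast
    linear_combination 2 * det_eq_one
  · rw [dotPoly_comm, dot_comm, of_lt h]

theorem piQ_triplePoly_apply (i j k : Fin n) (hij : i < j) (hjk : j < k) :
    piQ x (triplePoly i j k hij hjk) ρ =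
      triple (coordP x ρ) (coordQ x ρ) (coordR x ρ) i j k := by
  simp only [triplePoly, map_add, map_sub, map_mul (piQ x), map_one, Pi.add_apply, Pi.sub_apply,
    Pi.mul_apply, Pi.one_apply, piQ_t'_apply, piQ_C_apply, triple, coordP, coordQ, coordR,
    Index.word, coe_rep_mul, trace_fin_two, mul_apply, Fin.sum_univ_two]
  push_cast
  ring

theorem dotPoly_mul_triplePoly_relation_mem_IQ (m : Fin n) {i j k l : Fin n} (hij : i < j)
    (hjk : j < k) (hkl : k < l) :
    dotPoly m i * triplePoly j k l hjk hkl - dotPoly m j * triplePoly i k l (hij.trans hjk) hkl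
      + dotPoly m k * triplePoly i j l hij (hjk.trans hkl)
      - dotPoly m l * triplePoly i j k hij hjk ∈ IQ x := by
  refine (mem_IQ_iff x).2 fun ρ => ?_
  simpa only [map_add, map_sub, map_mul, Pi.add_apply, Pi.sub_apply, Pi.mul_apply,
    piQ_dotPoly_apply, piQ_triplePoly_apply] using dot_mul_triple_relation ..

end Evaluation

theorem dotPoly_mem_J₀ (i j : Fin n) : dotPoly i j ∈ J₀ n := by
  unfold dotPoly
  split_ifs
  · exact add_mem (Ideal.mul_mem_left _ _ (t'_mem_J₀ _))
      (Ideal.mul_mem_left _ _ (Ideal.pow_mem_of_mem _ (t'_mem_J₀ _) 2 two_pos))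
  · exact sub_mem (sub_mem (sub_mem (tSym_mem_J₀ _ _) (t'_mem_J₀ _)) (t'_mem_J₀ _))
      (Ideal.mul_mem_left _ _ (Ideal.mul_mem_left _ _ (t'_mem_J₀ _)))

theorem triplePoly_mem_J₀ {i j k : Fin n} (hij : i < j) (hjk : j < k) :
    triplePoly i j k hij hjk ∈ J₀ n := by
  rw [triplePoly]
  refine add_mem (add_mem (add_mem (sub_mem (sub_mem (sub_mem ?_ ?_) ?_) ?_) ?_) ?_) ?_
  any_goals exact t'_mem_J₀ _
  all_goals exact Ideal.mul_mem_right _ _ (t'_mem_J₀ _)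

theorem triplePoly_mul_triplePoly_mem {G : Type*} [Group G] (x : Fin n → G) {i j k a b c : Fin n}
    (hij : i < j) (hjk : j < k) (hab : a < b) (hbc : b < c) :
    triplePoly i j k hij hjk * triplePoly a b c hab hbc ∈ J₀ n ^ 3 ⊔ IQ x := by
  set gram : Poly n :=
    dotPoly i a * (dotPoly j b * dotPoly k c - dotPoly j c * dotPoly k b)
      - dotPoly i b * (dotPoly j a * dotPoly k c - dotPoly j c * dotPoly k a)
      + dotPoly i c * (dotPoly j a * dotPoly k b - dotPoly j b * dotPoly k a) with hgram
  have add_gram_mem_IQ : triplePoly i j k hij hjk * triplePoly a b c hab hbc + C (1 / 2) * gram ∈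
      IQ x := by
    refine (mem_IQ_iff x).2 fun ρ => ?_
    simp only [hgram, map_add, map_sub, map_mul, Pi.add_apply, Pi.sub_apply, Pi.mul_apply,
      piQ_dotPoly_apply, piQ_triplePoly_apply, piQ_C_apply]
    push_cast
    linear_combination (1 / 2) * two_mul_triple_mul_triple (coordP x ρ) (coordQ x ρ)
      (coordR x ρ) i j k a b c
  have gram_mem : gram ∈ J₀ n ^ 3 := by
    have dotPoly_prod_mem (i₁ j₁ i₂ j₂ i₃ j₃ : Fin n) :
        dotPoly i₁ j₁ * (dotPoly i₂ j₂ * dotPoly i₃ j₃) ∈ J₀ n ^ 3 := by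
      rw [pow_succ', pow_two]
      exact Ideal.mul_mem_mul (dotPoly_mem_J₀ _ _)
        (Ideal.mul_mem_mul (dotPoly_mem_J₀ _ _) (dotPoly_mem_J₀ _ _))
    simp only [hgram, mul_sub]
    refine add_mem (sub_mem (sub_mem ?_ ?_) (sub_mem ?_ ?_)) (sub_mem ?_ ?_)
    all_goals exact dotPoly_prod_mem _ _ _ _ _ _
  rw [← add_sub_cancel_right (triplePoly i j k hij hjk * _) (C (1 / 2) * gram)]
  exact sub_mem (Ideal.mem_sup_right add_gram_mem_IQ)
    (Ideal.mem_sup_left (Ideal.mul_mem_left _ _ gram_mem))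

end InvariantPolynomials

section Spanning

open scoped Pointwise

variable {n : ℕ}

theorem t₁_mul_t'_mem_S (i : Fin n) (s : Index n) : t₁ i * t' s ∈ S n := by
  left
  rcases s with j | ⟨j, k, h⟩ | ⟨j, k, l, h, h'⟩
  · refine .inl (.inl (.inl ?_))
    rcases le_total i j with h | h
    · exact ⟨i, j, h, rfl⟩
    · exact ⟨j, i, h, mul_comm _ _⟩
  · exact .inl (.inl (.inr ⟨i, j, k, h, rfl⟩))
  · exact .inl (.inr ⟨i, j, k, l, h, h', rfl⟩)

theorem t₂_mul_t₂_mem_S {i j a b : Fin n} (hij : i < j) (hab : a < b) :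
    t₂ i j hij * t₂ a b hab ∈ S n := by
  refine .inl (.inr ?_)
  rcases le_total (toLex (i, j)) (toLex (a, b)) with h | h
  · exact ⟨i, j, a, b, hij, hab, h, rfl⟩
  · exact ⟨a, b, i, j, hab, hij, h, mul_comm _ _⟩

/-- The condition on `p < q` and `a < b < c` under which `t'_{pq} t'_{abc}` is not in `S`. -/
def Excluded {ι : Type*} [LT ι] (p q a b c : ι) : Prop :=
  (p < a ∧ q ≠ a ∧ q ≠ b ∧ q ≠ c) ∨ (p = a ∧ c < q) ∨ (p = b ∧ c < q) ∨ p = c ∨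
    (b < p ∧ p < c ∧ q = c)

theorem t₂_mul_t₃_mem_S_of_lt {p q a b c : Fin n} (hpq : p < q) (hab : a < b) (hbc : b < c)
    (ha : a < p) (h : ¬ Excluded p q a b c) : t₂ p q hpq * t₃ a b c hab hbc ∈ S n := by
  simp only [Excluded, not_or, not_and] at h
  obtain ⟨-, -, h3, h4, h5⟩ := h
  right
  rcases lt_trichotomy p b with hb | rfl | hb
  · rcases lt_trichotomy q b with hb' | rfl | hb'
    · exact .inr ⟨a, p, q, b, c, ha, hpq, hb', hbc, .inl rfl⟩
    · exact .inl (.inr ⟨a, p, q, c, ha, hb, hbc, .inr (.inr (.inr (.inr (.inr (.inl rfl)))))⟩)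
    rcases lt_trichotomy q c with hc' | rfl | hc'
    · exact .inr ⟨a, p, b, q, c, ha, hb, hb', hc', .inr (.inl rfl)⟩
    · exact .inl (.inr ⟨a, p, b, q, ha, hb, hbc,
        .inr (.inr (.inr (.inr (.inr (.inr (.inl rfl))))))⟩)
    · exact .inr ⟨a, p, b, c, q, ha, hb, hbc, hc', .inr (.inr (.inl rfl))⟩
  · left
    rcases lt_trichotomy q c with hc' | rfl | hc'
    · exact .inr ⟨a, p, q, c, hab, hpq, hc', .inr (.inr (.inr (.inr (.inl rfl))))⟩
    · exact .inl ⟨a, p, q, hab, hbc, .inr (.inr rfl)⟩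
    · exact absurd hc' (h3 rfl)
  rcases lt_trichotomy p c with hc | rfl | hc
  · rcases lt_trichotomy q c with hc' | rfl | hc'
    · exact .inr ⟨a, b, p, q, c, hab, hb, hpq, hc', .inr (.inr (.inr (.inl rfl)))⟩
    · exact absurd rfl (h5 hb hc)
    · exact .inr ⟨a, b, p, c, q, hab, hb, hc, hc', .inr (.inr (.inr (.inr (.inl rfl))))⟩
  · exact absurd rfl h4
  · exact .inr ⟨a, b, c, p, q, hab, hbc, hc, hpq, .inr (.inr (.inr (.inr (.inr rfl))))⟩

theorem t₂_mul_t₃_mem_S {p q a b c : Fin n} (hpq : p < q) (hab : a < b) (hbc : b < c)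
    (h : ¬ Excluded p q a b c) : t₂ p q hpq * t₃ a b c hab hbc ∈ S n := by
  rcases lt_or_ge a p with ha | ha
  · exact t₂_mul_t₃_mem_S_of_lt hpq hab hbc ha h
  simp only [Excluded, not_or, not_and] at h
  obtain ⟨h1, h2, -⟩ := h
  right
  rcases ha.lt_or_eq with ha | rfl
  · left; right
    by_cases e1 : q = a
    · subst e1
      exact ⟨p, q, b, c, ha, hab, hbc, .inl rfl⟩
    by_cases e2 : q = b
    · subst e2
      exact ⟨p, a, q, c, ha, hab, hbc, .inr (.inl rfl)⟩
    by_cases e3 : q = c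
    · subst e3
      exact ⟨p, a, b, q, ha, hab, hbc, .inr (.inr (.inl rfl))⟩
    exact absurd e3 (h1 ha e1 e2)
  · left
    rcases lt_trichotomy q b with hb | rfl | hb
    · exact .inr ⟨p, q, b, c, hpq, hb, hbc, .inr (.inr (.inr (.inl rfl)))⟩
    · exact .inl ⟨p, q, c, hab, hbc, .inl rfl⟩
    rcases lt_trichotomy q c with hc | rfl | hc
    · exact .inr ⟨p, b, q, c, hab, hb, hc, .inr (.inr (.inr (.inr (.inr (.inr (.inr rfl))))))⟩
    · exact .inl ⟨p, b, q, hab, hbc, .inr (.inl rfl)⟩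
    · exact absurd hc (h2 rfl)

theorem t₂_mul_t₃_not_mem_S {p q a b c : Fin n} (hpq : p < q) (hab : a < b) (hbc : b < c)
    (h : Excluded p q a b c) : t₂ p q hpq * t₃ a b c hab hbc ∉ S n := by
  intro hS
  unfold Excluded at h
  rcases hS with (((⟨i, j, _, e⟩ | ⟨i, j, k, _, e⟩) | ⟨i, j, k, l, _, _, e⟩) |
    ⟨i, j, k, l, _, _, _, e⟩) | ((⟨i, j, k, _, _, e | e | e⟩ |
    ⟨i, j, k, l, _, _, _, e | e | e | e | e | e | e | e⟩) |
    ⟨i, j, k, l, m, _, _, _, _, e | e | e | e | e | e⟩)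
  all_goals
    rw [t'_mul_t'_eq_iff] at e
    simp only [Index.two.injEq, Index.three.injEq, reduceCtorEq, and_false, false_and, or_false,
      or_self] at e
  all_goals
    obtain ⟨⟨rfl, rfl⟩, rfl, rfl, rfl⟩ := e
    grind

theorem t₃_mul_t₃_not_mem_S {p q r a b c : Fin n} (hpq : p < q) (hqr : q < r) (hab : a < b)
    (hbc : b < c) : t₃ p q r hpq hqr * t₃ a b c hab hbc ∉ S n := by
  intro hS
  rcases hS with (((⟨i, j, _, e⟩ | ⟨i, j, k, _, e⟩) | ⟨i, j, k, l, _, _, e⟩) |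
    ⟨i, j, k, l, _, _, _, e⟩) | ((⟨i, j, k, _, _, e | e | e⟩ |
    ⟨i, j, k, l, _, _, _, e | e | e | e | e | e | e | e⟩) |
    ⟨i, j, k, l, m, _, _, _, _, e | e | e | e | e | e⟩)
  all_goals
    rw [t'_mul_t'_eq_iff] at e
    simp only [reduceCtorEq, and_false, false_and, or_self] at e

variable {G : Type*} [Group G] (x : Fin n → G)

/-- The polynomials that are `ℚ`-combinations of `S` modulo `J₀ ^ 3` and `I_ℚ`. -/
noncomputable def spanS : Submodule ℚ (Poly n) :=
  Submodule.span ℚ (S n) ⊔ (J₀ n ^ 3 ⊔ IQ x).restrictScalars ℚ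

variable {x}

theorem mem_spanS_of_mem_sup {p : Poly n} (hp : p ∈ J₀ n ^ 3 ⊔ IQ x) : p ∈ spanS x :=
  Submodule.mem_sup_right hp

theorem mem_spanS_of_mem_S {p : Poly n} (hp : p ∈ S n) : p ∈ spanS x :=
  Submodule.mem_sup_left (Submodule.subset_span hp)

theorem t₁_mul_mem_spanS (i : Fin n) {v : Poly n} (hv : v ∈ J₀ n) : t₁ i * v ∈ spanS x := by
  obtain ⟨y, hy, z, hz, rfl⟩ := Submodule.mem_sup.1 (mem_span_rat_sup_J₀_mul hv)
  have hz' : t₁ i * z ∈ J₀ n ^ 3 := by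
    rw [pow_succ', pow_two]
    exact Ideal.mul_mem_mul (t'_mem_J₀ _) hz
  rw [mul_add]
  refine add_mem ?_ (mem_spanS_of_mem_sup (Ideal.mem_sup_left hz'))
  suffices Submodule.span ℚ (T n) ≤ (spanS x).comap (LinearMap.mulLeft ℚ (t₁ i)) from this hy
  rw [Submodule.span_le, T_eq_range]
  rintro _ ⟨s, rfl⟩
  exact mem_spanS_of_mem_S (t₁_mul_t'_mem_S i s)

theorem tSym_mul_t₂_mem_spanS (i j : Fin n) {a b : Fin n} (hab : a < b) :
    tSym i j * t₂ a b hab ∈ spanS x := by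
  unfold tSym
  split_ifs
  · exact mem_spanS_of_mem_S (t₂_mul_t₂_mem_S ..)
  · exact mem_spanS_of_mem_S (t₂_mul_t₂_mem_S ..)
  · rw [zero_mul]; exact zero_mem _

theorem triplePoly_sub_t₃_mul_mem_spanS {a b c : Fin n} (hab : a < b) (hbc : b < c) {v : Poly n}
    (hv : v ∈ J₀ n) (h : ∀ (p q : Fin n) (hpq : p < q), t₂ p q hpq * v ∈ spanS x) :
    (triplePoly a b c hab hbc - t₃ a b c hab hbc) * v ∈ spanS x := by
  have t₁_mul (l : Fin n) (p : Poly n) : t₁ l * (p * v) ∈ spanS x :=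
    t₁_mul_mem_spanS l (Ideal.mul_mem_left _ _ hv)
  have t₂_part := neg_mem (add_mem (add_mem (h a b hab) (h a c (hab.trans hbc))) (h b c hbc))
  convert add_mem (add_mem (add_mem t₂_part
    (t₁_mul a (1 - C (1 / 2) * t₂ b c hbc + t₁ b + C (1 / 2) * (t₁ b * t₁ c))))
    (t₁_mul b (1 - C (1 / 2) * t₂ a c (hab.trans hbc) + t₁ c)))
    (t₁_mul c (1 - C (1 / 2) * t₂ a b hab + t₁ a)) using 1
  rw [triplePoly]
  ring

theorem dotPoly_mul_triplePoly_sub_mem_spanS (m r : Fin n) {i j k : Fin n} (hij : i < j)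
    (hjk : j < k) :
    dotPoly m r * triplePoly i j k hij hjk - tSym m r * t₃ i j k hij hjk ∈ spanS x := by
  have t₁_mul (l : Fin n) (p : Poly n) : t₁ l * (p * triplePoly i j k hij hjk) ∈ spanS x :=
    t₁_mul_mem_spanS l (Ideal.mul_mem_left _ _ (triplePoly_mem_J₀ hij hjk))
  by_cases h : m = r
  · subst h
    convert t₁_mul m (2 + C (1 / 2) * t₁ m) using 1
    rw [dotPoly, if_pos rfl, tSym_self]
    ring
  · have tSym_part := triplePoly_sub_t₃_mul_mem_spanS hij hjk (tSym_mem_J₀ m r)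
      fun p q hpq => mul_comm (tSym m r) _ ▸ tSym_mul_t₂_mem_spanS (x := x) m r hpq
    convert add_mem (add_mem (t₁_mul m (-1 - C (1 / 2) * t₁ r)) (t₁_mul r (-1))) tSym_part using 1
    rw [dotPoly, if_neg h]
    ring

theorem tSym_mul_t₃_relation_mem_spanS (m : Fin n) {i j k l : Fin n} (hij : i < j) (hjk : j < k)
    (hkl : k < l) :
    tSym m i * t₃ j k l hjk hkl - tSym m j * t₃ i k l (hij.trans hjk) hkl
      + tSym m k * t₃ i j l hij (hjk.trans hkl) - tSym m l * t₃ i j k hij hjk ∈ spanS x := by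
  have relation : _ ∈ spanS x := mem_spanS_of_mem_sup (Ideal.mem_sup_right
    (dotPoly_mul_triplePoly_relation_mem_IQ x m hij hjk hkl))
  have sub_i := dotPoly_mul_triplePoly_sub_mem_spanS (x := x) m i hjk hkl
  have sub_j := dotPoly_mul_triplePoly_sub_mem_spanS (x := x) m j (hij.trans hjk) hkl
  have sub_k := dotPoly_mul_triplePoly_sub_mem_spanS (x := x) m k hij (hjk.trans hkl)
  have sub_l := dotPoly_mul_triplePoly_sub_mem_spanS (x := x) m l hij hjk
  convert sub_mem relation (sub_mem (add_mem (sub_mem sub_i sub_j) sub_k) sub_l) using 1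
  ring

theorem tSym_mul_t₃_mem_spanS {p q a b c : Fin n} (hpq : p ≠ q) (hab : a < b)
    (hbc : b < c) (h : ¬ Excluded (min p q) (max p q) a b c) :
    tSym p q * t₃ a b c hab hbc ∈ spanS x := by
  rcases lt_or_gt_of_ne hpq with h' | h'
  · rw [tSym_of_lt h']
    rw [min_eq_left h'.le, max_eq_right h'.le] at h
    exact mem_spanS_of_mem_S (t₂_mul_t₃_mem_S h' hab hbc h)
  · rw [tSym_of_gt h']
    rw [min_eq_right h'.le, max_eq_left h'.le] at h
    exact mem_spanS_of_mem_S (t₂_mul_t₃_mem_S h' hab hbc h)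

theorem t₂_mul_t₃_mem_spanS {p q a b c : Fin n} (hpq : p < q) (hab : a < b) (hbc : b < c) :
    t₂ p q hpq * t₃ a b c hab hbc ∈ spanS x := by
  by_cases h : Excluded p q a b c
  swap
  · exact mem_spanS_of_mem_S (t₂_mul_t₃_mem_S hpq hab hbc h)
  rw [← tSym_of_lt hpq]
  -- In each case the relation below has this product as its only excluded term.
  rcases h with ⟨hpa, hqa, hqb, hqc⟩ | ⟨rfl, hcq⟩ | ⟨rfl, hcq⟩ | rfl | ⟨hbp, hpc, rfl⟩
  · have relation := tSym_mul_t₃_relation_mem_spanS (x := x) q hpa hab hbc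
    convert add_mem (sub_mem (add_mem relation
      (tSym_mul_t₃_mem_spanS hqa (hpa.trans hab) hbc (by grind [Excluded])))
      (tSym_mul_t₃_mem_spanS hqb hpa (hab.trans hbc) (by grind [Excluded])))
      (tSym_mul_t₃_mem_spanS hqc hpa hab (by grind [Excluded])) using 1
    rw [tSym_comm p q]
    ring
  · have relation := tSym_mul_t₃_relation_mem_spanS (x := x) p hab hbc hcq
    convert neg_mem (sub_mem (add_mem relation
      (tSym_mul_t₃_mem_spanS hab.ne (hab.trans hbc) hcq (by grind [Excluded])))
      (tSym_mul_t₃_mem_spanS (hab.trans hbc).ne hab (hbc.trans hcq) (by grind [Excluded]))) using 1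
    rw [tSym_self]
    ring
  · have relation := tSym_mul_t₃_relation_mem_spanS (x := x) p hab hbc hcq
    convert neg_mem (sub_mem (sub_mem relation
      (tSym_mul_t₃_mem_spanS hab.ne' hbc hcq (by grind [Excluded])))
      (tSym_mul_t₃_mem_spanS hbc.ne hab (hbc.trans hcq) (by grind [Excluded]))) using 1
    rw [tSym_self]
    ring
  · have relation := tSym_mul_t₃_relation_mem_spanS (x := x) p hab hbc hpq
    convert neg_mem (add_mem (sub_mem relation
      (tSym_mul_t₃_mem_spanS (hab.trans hbc).ne' hbc hpq (by grind [Excluded])))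
      (tSym_mul_t₃_mem_spanS hbc.ne' (hab.trans hbc) hpq (by grind [Excluded]))) using 1
    rw [tSym_self]
    ring
  · have relation := tSym_mul_t₃_relation_mem_spanS (x := x) q hab hbp hpc
    convert add_mem (sub_mem relation
      (tSym_mul_t₃_mem_spanS (hab.trans hbc).ne' hbp hpc (by grind [Excluded])))
      (tSym_mul_t₃_mem_spanS hbc.ne' (hab.trans hbp) hpc (by grind [Excluded])) using 1
    rw [tSym_comm p q, tSym_self]
    ring

theorem t₃_mul_t₃_mem_spanS {p q r a b c : Fin n} (hpq : p < q) (hqr : q < r) (hab : a < b)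
    (hbc : b < c) : t₃ p q r hpq hqr * t₃ a b c hab hbc ∈ spanS x := by
  have triple_triple : _ ∈ spanS x :=
    mem_spanS_of_mem_sup (triplePoly_mul_triplePoly_mem x hpq hqr hab hbc)
  have t₂_mul_triple (i j : Fin n) (hij : i < j) :
      t₂ i j hij * triplePoly a b c hab hbc ∈ spanS x := by
    have h := triplePoly_sub_t₃_mul_mem_spanS (x := x) hab hbc (t'_mem_J₀ (.two i j hij))
      fun _ _ _ => mem_spanS_of_mem_S (t₂_mul_t₂_mem_S ..)
    convert add_mem h (t₂_mul_t₃_mem_spanS hij hab hbc) using 1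
    ring
  have sub_triple := triplePoly_sub_t₃_mul_mem_spanS hpq hqr (triplePoly_mem_J₀ hab hbc)
    t₂_mul_triple
  have sub_t₃ := triplePoly_sub_t₃_mul_mem_spanS (x := x) hab hbc (t'_mem_J₀ (.three p q r hpq hqr))
    fun _ _ h => t₂_mul_t₃_mem_spanS h hpq hqr
  convert sub_mem (sub_mem triple_triple sub_triple) sub_t₃ using 1
  ring

theorem t'_mul_t'_mem_spanS (s r : Index n) : t' s * t' r ∈ spanS x := by
  rcases s with i | ⟨i, j, hij⟩ | ⟨i, j, k, hij, hjk⟩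
  · exact mem_spanS_of_mem_S (t₁_mul_t'_mem_S _ _)
  · rcases r with a | ⟨a, b, hab⟩ | ⟨a, b, c, hab, hbc⟩
    · exact mul_comm (t₁ a) _ ▸ mem_spanS_of_mem_S (t₁_mul_t'_mem_S _ _)
    · exact mem_spanS_of_mem_S (t₂_mul_t₂_mem_S hij hab)
    · exact t₂_mul_t₃_mem_spanS hij hab hbc
  · rcases r with a | ⟨a, b, hab⟩ | ⟨a, b, c, hab, hbc⟩
    · exact mul_comm (t₁ a) _ ▸ mem_spanS_of_mem_S (t₁_mul_t'_mem_S _ _)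
    · exact mul_comm (t₂ a b hab) _ ▸ t₂_mul_t₃_mem_spanS hab hij hjk
    · exact t₃_mul_t₃_mem_spanS hij hjk hab hbc

theorem J₀_sq_le_spanS : (J₀ n ^ 2).restrictScalars ℚ ≤ spanS x := by
  intro p hp
  have J₀_sq_eq : J₀ n ^ 2 = Ideal.span (T n * T n) := by
    rw [pow_two, J₀, Ideal.span_mul_span']
  have split := mem_span_rat_sup_J₀_mul (J₀_sq_eq ▸ hp)
  rw [← J₀_sq_eq, ← pow_succ'] at split
  obtain ⟨y, hy, z, hz, rfl⟩ := Submodule.mem_sup.1 split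
  refine add_mem (Submodule.span_le.2 ?_ hy) (mem_spanS_of_mem_sup (Ideal.mem_sup_left hz))
  rw [T_eq_range]
  rintro _ ⟨_, ⟨s, rfl⟩, _, ⟨r, rfl⟩, rfl⟩
  exact t'_mul_t'_mem_spanS s r

end Spanning

section LeadingForms

variable {n : ℕ}

/-- An injective code of the indices, witnessing that there are finitely many. -/
def Index.code : Index n → Fin n × Option (Fin n) × Option (Fin n)
  | .one i => (i, none, none)
  | .two i j _ => (i, some j, none)
  | .three i j k _ _ => (i, some j, some k)

theorem Index.code_injective : Function.Injective (Index.code (n := n)) := by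
  rintro (_ | _ | _) (_ | _ | _) h <;> simp_all [Index.code]

noncomputable instance : Fintype (Index n) := Fintype.ofInjective _ Index.code_injective

section Definitions

variable {K : Type*} [CommRing K]

/-- The sum of a vector over the entries of an index. -/
def Index.sum (P : Fin n → K) : Index n → K
  | .one i => P i
  | .two i j _ => P i + P j
  | .three i j k _ _ => P i + P j + P k

/-- The minor of the matrix with columns `P`, `Q`, `R` on the rows given by an index of length
three, and `0` for the other indices. -/
def Index.minor (P Q R : Fin n → K) : Index n → K
  | .one _ => 0
  | .two _ _ _ => 0
  | .three i j k _ _ => triple P Q R i j k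

/-- The quadratic form `-det` of the sum of the traceless matrices `!![P i, Q i; R i, -P i]` over
the entries `i` of an index. -/
def Index.quad (P Q R : Fin n → K) (s : Index n) : K :=
  s.sum P ^ 2 + s.sum Q * s.sum R

variable (P Q R : Fin n → K) (s : Index n)

theorem Index.sum_smul (a : K) : s.sum (a • P) = a * s.sum P := by
  rcases s with i | ⟨i, j, h⟩ | ⟨i, j, k, h, h'⟩ <;>
    simp only [Index.sum, Pi.smul_apply, smul_eq_mul] <;> ring

theorem Index.quad_smul (a : K) : s.quad (a • P) (a • Q) (a • R) = a ^ 2 * s.quad P Q R := by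
  simp only [Index.quad, Index.sum_smul]
  ring

theorem Index.minor_smul (a : K) : s.minor (a • P) Q R = a * s.minor P Q R := by
  rcases s with i | ⟨i, j, h⟩ | ⟨i, j, k, h, h'⟩ <;>
    simp only [Index.minor, triple, Pi.smul_apply, smul_eq_mul] <;> ring

theorem Index.minor_swap₁₂ : s.minor P Q R = -s.minor Q P R := by
  rcases s with i | ⟨i, j, h⟩ | ⟨i, j, k, h, h'⟩ <;> simp only [Index.minor, triple] <;> ring

theorem Index.minor_swap₂₃ : s.minor P Q R = -s.minor P R Q := by
  rcases s with i | ⟨i, j, h⟩ | ⟨i, j, k, h, h'⟩ <;> simp only [Index.minor, triple] <;> ring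

theorem Index.minor_smul_smul_smul (a : K) :
    s.minor (a • P) (a • Q) (a • R) = a ^ 3 * s.minor P Q R := by
  rcases s with i | ⟨i, j, h⟩ | ⟨i, j, k, h, h'⟩ <;>
    simp only [Index.minor, triple, Pi.smul_apply, smul_eq_mul] <;> ring

end Definitions

/-- A polynomial congruent to `t' s` modulo `J₀ ^ 2` that evaluates to the sum of a quadratic and
a cubic form in the traceless parts of the `ρ (x i)`. -/
noncomputable def model : Index n → Poly n
  | .one i => C (1 / 2) * dotPoly i i
  | .two i j _ => dotPoly i j + C (1 / 2) * (dotPoly i i + dotPoly j j)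
  | .three i j k hij hjk => triplePoly i j k hij hjk + dotPoly i j + dotPoly i k + dotPoly j k
      + C (1 / 2) * (dotPoly i i + dotPoly j j + dotPoly k k)

theorem piQ_model_apply {G : Type*} [Group G] (x : Fin n → G) (ρ : Rep G) (s : Index n) :
    piQ x (model s) ρ = s.quad (coordP x ρ) (coordQ x ρ) (coordR x ρ)
      + s.minor (coordP x ρ) (coordQ x ρ) (coordR x ρ) := by
  rcases s with i | ⟨i, j, hij⟩ | ⟨i, j, k, hij, hjk⟩ <;>
    simp only [model, map_add, map_mul, Pi.add_apply, Pi.mul_apply, piQ_C_apply,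
      piQ_dotPoly_apply, piQ_triplePoly_apply, Index.quad, Index.minor, Index.sum, dot] <;>
    push_cast <;> ring

theorem half_dotPoly_self_sub_mem (i : Fin n) :
    C (1 / 2) * dotPoly i i - t₁ i ∈ J₀ n ^ 2 := by
  have half_mul_two : C (1 / 2) * 2 = (1 : Poly n) := by
    rw [← map_ofNat C 2, ← C_mul, one_div_mul_cancel two_ne_zero, C_1]
  convert Ideal.mul_mem_left _ (C (1 / 2) * C (1 / 2))
    (t'_mul_t'_mem_J₀_sq (Index.one i) (Index.one i)) using 1
  rw [dotPoly, if_pos rfl]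
  linear_combination t₁ i * half_mul_two

theorem dotPoly_sub_mem {i j : Fin n} (hij : i < j) :
    dotPoly i j - (t₂ i j hij - t₁ i - t₁ j) ∈ J₀ n ^ 2 := by
  convert Ideal.mul_mem_left _ (-C (1 / 2))
    (t'_mul_t'_mem_J₀_sq (Index.one i) (Index.one j)) using 1
  rw [dotPoly, if_neg hij.ne, tSym_of_lt hij]
  ring

theorem triplePoly_sub_mem {i j k : Fin n} (hij : i < j) (hjk : j < k) :
    triplePoly i j k hij hjk - (t₃ i j k hij hjk - t₂ i j hij - t₂ i k (hij.trans hjk)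
      - t₂ j k hjk + t₁ i + t₁ j + t₁ k) ∈ J₀ n ^ 2 := by
  have mul_prod_mem (p : Poly n) (s r : Index n) : p * (t' s * t' r) ∈ J₀ n ^ 2 :=
    Ideal.mul_mem_left _ _ (t'_mul_t'_mem_J₀_sq s r)
  convert add_mem (add_mem (add_mem (add_mem (add_mem
    (mul_prod_mem (-C (1 / 2)) (.one i) (.two j k hjk))
    (mul_prod_mem (1 + C (1 / 2) * t₁ k) (.one i) (.one j)))
    (mul_prod_mem (-C (1 / 2)) (.one j) (.two i k (hij.trans hjk))))
    (mul_prod_mem 1 (.one j) (.one k)))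
    (mul_prod_mem (-C (1 / 2)) (.one k) (.two i j hij)))
    (mul_prod_mem 1 (.one k) (.one i)) using 1
  rw [triplePoly]
  ring

theorem model_sub_t'_mem (s : Index n) : model s - t' s ∈ J₀ n ^ 2 := by
  rcases s with i | ⟨i, j, hij⟩ | ⟨i, j, k, hij, hjk⟩
  · exact half_dotPoly_self_sub_mem i
  · convert add_mem (dotPoly_sub_mem hij)
      (add_mem (half_dotPoly_self_sub_mem i) (half_dotPoly_self_sub_mem j)) using 1
    rw [model]
    ring
  · convert add_mem (add_mem (triplePoly_sub_mem hij hjk) (add_mem (add_mem (dotPoly_sub_mem hij)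
      (dotPoly_sub_mem (hij.trans hjk))) (dotPoly_sub_mem hjk)))
      (add_mem (add_mem (half_dotPoly_self_sub_mem i) (half_dotPoly_self_sub_mem j))
        (half_dotPoly_self_sub_mem k)) using 1
    rw [model]
    ring

end LeadingForms

section ScaledRepresentation

open Asymptotics Filter
open scoped Topology

theorem eq_zero_of_const_mul_pow_isBigO {a : ℂ} {m : ℕ}
    (h : (fun z : ℂ => a * z ^ m) =O[𝓝 0] fun z => z ^ (m + 1)) : a = 0 := by
  by_contra ha
  have pow_isLittleO : (fun z : ℂ => z ^ m) =o[𝓝 0] fun z => z ^ m :=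
    ((isBigO_const_mul_left_iff ha).1 h).trans_isLittleO (isLittleO_pow_pow m.lt_succ_self)
  have frequently_ne : ∃ᶠ z : ℂ in 𝓝 0, z ^ m ≠ 0 :=
    ((eventually_mem_nhdsWithin (s := {0}ᶜ)).frequently.filter_mono nhdsWithin_le_nhds).mono
      fun _ hz => pow_ne_zero m hz
  exact isLittleO_irrefl frequently_ne pow_isLittleO

theorem eq_zero_of_add_isBigO {a b : ℂ} {m : ℕ}
    (h : (fun z : ℂ => a * z ^ m + b * z ^ (m + 1)) =O[𝓝 0] fun z => z ^ (m + 2)) :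
    a = 0 ∧ b = 0 := by
  have ha : a = 0 := by
    refine eq_zero_of_const_mul_pow_isBigO (m := m) ?_
    have b_part : (fun z : ℂ => b * z ^ (m + 1)) =O[𝓝 0] fun z => z ^ (m + 1) :=
      (isBigO_refl _ _).const_mul_left b
    simpa using (h.trans (isLittleO_pow_pow (m + 1).lt_succ_self).isBigO).sub b_part
  subst ha
  exact ⟨rfl, eq_zero_of_const_mul_pow_isBigO (m := m + 1) (by simpa using h)⟩

theorem trace_sub_two_isBigO {A : ℂ → SpecialLinearGroup (Fin 2) ℂ} (hA₀ : A 0 = 1)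
    (hA : ∀ i j, DifferentiableAt ℂ (fun z => A z i j) 0) :
    (fun z => trace (A z : Matrix (Fin 2) (Fin 2) ℂ) - 2) =O[𝓝 0] fun z => z ^ 2 := by
  have sub_one_isBigO (i j : Fin 2) :
      (fun z => A z i j - (1 : Matrix (Fin 2) (Fin 2) ℂ) i j) =O[𝓝 0] fun z => z := by
    simpa [hA₀] using (hA i j).isBigO_sub
  have trace_eq (z : ℂ) : trace (A z : Matrix (Fin 2) (Fin 2) ℂ) - 2 =
      (A z 0 1 - 0) * (A z 1 0 - 0) - (A z 0 0 - 1) * (A z 1 1 - 1) := by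
    have det_eq_one := (A z).det_coe
    rw [det_fin_two] at det_eq_one
    rw [trace_fin_two]
    linear_combination det_eq_one
  simp only [trace_eq, pow_two]
  exact ((sub_one_isBigO 0 1).mul (sub_one_isBigO 1 0)).sub
    ((sub_one_isBigO 0 0).mul (sub_one_isBigO 1 1))

section Family

variable {n : ℕ} {G : Type*} [Group G] {x : Fin n → G} {ρ : ℂ → Rep G}

theorem differentiableAt_coe_mul {g h : G} {z : ℂ}
    (hg : ∀ i j, DifferentiableAt ℂ (fun z => ρ z g i j) z)
    (hh : ∀ i j, DifferentiableAt ℂ (fun z => ρ z h i j) z) (i j : Fin 2) :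
    DifferentiableAt ℂ (fun z => ρ z (g * h) i j) z := by
  simp only [coe_rep_mul, mul_apply, Fin.sum_univ_two]
  exact ((hg i 0).mul (hh 0 j)).add ((hg i 1).mul (hh 1 j))

theorem piQ_t'_isBigO (hρ₀ : ρ 0 = 1)
    (hρ : ∀ k i j, DifferentiableAt ℂ (fun z => ρ z (x k) i j) 0) (s : Index n) :
    (fun z => piQ x (t' s) (ρ z)) =O[𝓝 0] fun z => z ^ 2 := by
  simp only [piQ_t'_apply]
  refine trace_sub_two_isBigO (by simp [hρ₀]) ?_
  rcases s with i | ⟨i, j, _⟩ | ⟨i, j, k, _, _⟩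
  · exact hρ i
  · exact differentiableAt_coe_mul (hρ i) (hρ j)
  · exact differentiableAt_coe_mul (differentiableAt_coe_mul (hρ i) (hρ j)) (hρ k)

theorem piQ_isBigO_one (hρ : ∀ s, (fun z => piQ x (t' s) (ρ z)) =O[𝓝 0] fun z => z ^ 2)
    (p : Poly n) : (fun z => piQ x p (ρ z)) =O[𝓝 0] fun _ => (1 : ℂ) := by
  induction p using MvPolynomial.induction_on with
  | C a => simpa only [piQ_C_apply] using isBigO_const_const (a : ℂ) one_ne_zero _
  | add p q hp hq => simpa only [map_add, Pi.add_apply] using hp.add hq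
  | mul_X p s hp =>
    have X_isBigO : (fun z => piQ x (t' s) (ρ z) + 2) =O[𝓝 0] fun _ => (1 : ℂ) := by
      refine .add ((hρ s).trans ?_) (isBigO_const_const _ one_ne_zero _)
      simpa using (isLittleO_pow_pow (𝕜 := ℂ) two_pos).isBigO
    have X_eq : X s = t' s + 2 := (sub_add_cancel _ _).symm
    simpa only [X_eq, map_mul, map_add, map_ofNat, Pi.mul_apply, Pi.add_apply, Pi.ofNat_apply,
      mul_one] using hp.mul X_isBigO

theorem piQ_isBigO_of_mem_J₀ (hρ : ∀ s, (fun z => piQ x (t' s) (ρ z)) =O[𝓝 0] fun z => z ^ 2)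
    {p : Poly n} (hp : p ∈ J₀ n) : (fun z => piQ x p (ρ z)) =O[𝓝 0] fun z => z ^ 2 := by
  rw [J₀_eq_span_range] at hp
  induction hp using Submodule.span_induction with
  | mem p hp =>
    obtain ⟨s, rfl⟩ := hp
    exact hρ s
  | zero => simpa using isBigO_zero _ _
  | add p q _ _ hp hq => simpa only [map_add, Pi.add_apply] using hp.add hq
  | smul f p _ hp => simpa [smul_eq_mul] using (piQ_isBigO_one hρ f).mul hp

theorem piQ_isBigO_of_mem_J₀_pow
    (hρ : ∀ s, (fun z => piQ x (t' s) (ρ z)) =O[𝓝 0] fun z => z ^ 2) {k : ℕ} {p : Poly n}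
    (hp : p ∈ J₀ n ^ k) : (fun z => piQ x p (ρ z)) =O[𝓝 0] fun z => z ^ (2 * k) := by
  induction k generalizing p with
  | zero => simpa using piQ_isBigO_one hρ p
  | succ k ih =>
    rw [pow_succ'] at hp
    induction hp using Submodule.mul_induction_on' with
    | mem_mul_mem p hp q hq =>
      simpa only [map_mul, Pi.mul_apply, mul_add_one, add_comm (2 * k), pow_add] using
        (piQ_isBigO_of_mem_J₀ hρ hp).mul (ih hq)
    | add p _ q _ hp hq => simpa only [map_add, Pi.add_apply] using hp.add hq

theorem piQ_isBigO_of_mem_sup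
    (hρ : ∀ s, (fun z => piQ x (t' s) (ρ z)) =O[𝓝 0] fun z => z ^ 2) {k : ℕ} {p : Poly n}
    (hp : p ∈ J₀ n ^ k ⊔ IQ x) : (fun z => piQ x p (ρ z)) =O[𝓝 0] fun z => z ^ (2 * k) := by
  obtain ⟨a, ha, b, hb, rfl⟩ := Submodule.mem_sup.1 hp
  simpa only [map_add, Pi.add_apply, (mem_IQ_iff x).1 hb, add_zero] using
    piQ_isBigO_of_mem_J₀_pow hρ ha

end Family

variable {n : ℕ}

/-- The representation sending the `i`-th generator to `w + z Yᵢ`, where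
`Yᵢ = !![P i, Q i; R i, -P i]` and `w` is the principal square root of `1 - z ^ 2 det Yᵢ`; its
traceless part is linear in `z`. -/
noncomputable def scaledRep (P Q R : Fin n → ℂ) (z : ℂ) : Rep (FreeGroup (Fin n)) :=
  FreeGroup.lift fun i =>
    ⟨!![(1 + z ^ 2 * (P i ^ 2 + Q i * R i)) ^ (2 : ℂ)⁻¹ + z * P i, z * Q i;
        z * R i, (1 + z ^ 2 * (P i ^ 2 + Q i * R i)) ^ (2 : ℂ)⁻¹ - z * P i], by
      rw [det_fin_two_of]
      linear_combination Complex.cpow_ofNat_inv_pow (1 + z ^ 2 * (P i ^ 2 + Q i * R i)) 2⟩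

variable (P Q R : Fin n → ℂ)

theorem coe_scaledRep_of (z : ℂ) (i : Fin n) :
    (scaledRep P Q R z (FreeGroup.of i) : Matrix (Fin 2) (Fin 2) ℂ) =
      !![(1 + z ^ 2 * (P i ^ 2 + Q i * R i)) ^ (2 : ℂ)⁻¹ + z * P i, z * Q i;
        z * R i, (1 + z ^ 2 * (P i ^ 2 + Q i * R i)) ^ (2 : ℂ)⁻¹ - z * P i] :=
  congrArg Subtype.val (FreeGroup.lift_apply_of (β := SpecialLinearGroup (Fin 2) ℂ))

theorem scaledRep_zero : scaledRep P Q R 0 = 1 := by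
  refine FreeGroup.ext_hom _ _ fun i => Subtype.ext ?_
  simp [coe_scaledRep_of, one_fin_two]

theorem differentiableAt_scaledRep_of (k : Fin n) (i j : Fin 2) :
    DifferentiableAt ℂ (fun z => scaledRep P Q R z (FreeGroup.of k) i j) 0 := by
  have sqrt_diff : DifferentiableAt ℂ
      (fun z : ℂ => (1 + z ^ 2 * (P k ^ 2 + Q k * R k)) ^ (2 : ℂ)⁻¹) 0 :=
    DifferentiableAt.cpow_const (by fun_prop) (by simp)
  simp only [coe_scaledRep_of]
  fin_cases i <;> fin_cases j <;>
    simp only [Fin.zero_eta, Fin.mk_one, of_apply, cons_val', cons_val_zero, cons_val_one,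
      cons_val_fin_one] <;>
    fun_prop

theorem piQ_model_scaledRep (s : Index n) (z : ℂ) :
    piQ FreeGroup.of (model s) (scaledRep P Q R z) =
      z ^ 2 * s.quad P Q R + z ^ 3 * s.minor P Q R := by
  have coordP_eq : coordP FreeGroup.of (scaledRep P Q R z) = z • P := by
    ext i
    simp [coordP, coe_scaledRep_of]
  have coordQ_eq : coordQ FreeGroup.of (scaledRep P Q R z) = z • Q := by
    ext i
    simp [coordQ, coe_scaledRep_of]
  have coordR_eq : coordR FreeGroup.of (scaledRep P Q R z) = z • R := by
    ext i
    simp [coordR, coe_scaledRep_of]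
  rw [piQ_model_apply, coordP_eq, coordQ_eq, coordR_eq, Index.quad_smul,
    Index.minor_smul_smul_smul]

theorem piQ_scaledRep_isBigO {k : ℕ} {p : Poly n} (hp : p ∈ J₀ n ^ k ⊔ IQ FreeGroup.of) :
    (fun z => piQ FreeGroup.of p (scaledRep P Q R z)) =O[𝓝 0] fun z => z ^ (2 * k) :=
  piQ_isBigO_of_mem_sup
    (piQ_t'_isBigO (scaledRep_zero P Q R) (differentiableAt_scaledRep_of P Q R)) hp

theorem leading_forms_eq_zero_of_linear {c : Index n → ℚ}
    (h : ∑ s, c s • t' s ∈ J₀ n ^ 2 ⊔ IQ FreeGroup.of) :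
    ∑ s, (c s : ℂ) * s.quad P Q R = 0 ∧ ∑ s, (c s : ℂ) * s.minor P Q R = 0 := by
  have model_mem : ∑ s, C (c s) * model s ∈ J₀ n ^ 2 ⊔ IQ FreeGroup.of := by
    have diff_mem : ∑ s, C (c s) * (model s - t' s) ∈ J₀ n ^ 2 ⊔ IQ FreeGroup.of :=
      sum_mem fun s _ => Ideal.mem_sup_left (Ideal.mul_mem_left _ _ (model_sub_t'_mem s))
    convert add_mem h diff_mem using 1
    rw [← Finset.sum_add_distrib]
    exact Finset.sum_congr rfl fun s _ => by rw [smul_eq_C_mul]; ring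
  refine eq_zero_of_add_isBigO (m := 2) ((piQ_scaledRep_isBigO P Q R model_mem).congr_left ?_)
  intro z
  simp only [map_sum, map_mul, Finset.sum_apply, Pi.mul_apply, piQ_C_apply, piQ_model_scaledRep,
    Finset.sum_mul, ← Finset.sum_add_distrib]
  exact Finset.sum_congr rfl fun s _ => by ring

theorem leading_forms_eq_zero_of_quadratic {c : Index n → Index n → ℚ}
    (h : ∑ s, ∑ r, c s r • (t' s * t' r) ∈ J₀ n ^ 3 ⊔ IQ FreeGroup.of) :
    ∑ s, ∑ r, (c s r : ℂ) * (s.quad P Q R * r.quad P Q R) = 0 ∧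
      ∑ s, ∑ r, (c s r : ℂ) * (s.quad P Q R * r.minor P Q R + s.minor P Q R * r.quad P Q R) =
        0 := by
  have model_mem : ∑ s, ∑ r, C (c s r) * (model s * model r) ∈ J₀ n ^ 3 ⊔ IQ FreeGroup.of := by
    have model_mem_J₀ (s : Index n) : model s ∈ J₀ n := by
      rw [← sub_add_cancel (model s) (t' s)]
      exact add_mem (Ideal.pow_le_self two_ne_zero (model_sub_t'_mem s)) (t'_mem_J₀ s)
    have diff_mem :
        ∑ s, ∑ r, C (c s r) * ((model s - t' s) * model r + (model r - t' r) * t' s) ∈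
          J₀ n ^ 3 ⊔ IQ FreeGroup.of :=
      sum_mem fun s _ => sum_mem fun r _ => Ideal.mem_sup_left (Ideal.mul_mem_left _ _ (add_mem
        (Ideal.mul_mem_mul (model_sub_t'_mem s) (model_mem_J₀ r))
        (Ideal.mul_mem_mul (model_sub_t'_mem r) (t'_mem_J₀ s))))
    convert add_mem h diff_mem using 1
    simp only [← Finset.sum_add_distrib]
    exact Finset.sum_congr rfl fun s _ => Finset.sum_congr rfl fun r _ => by
      rw [smul_eq_C_mul]; ring
  have minor_minor : (fun z : ℂ => (∑ s, ∑ r, (c s r : ℂ) * (s.minor P Q R * r.minor P Q R)) *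
      z ^ 6) =O[𝓝 0] fun z => z ^ 6 := (isBigO_refl _ _).const_mul_left _
  refine eq_zero_of_add_isBigO (m := 4)
    (((piQ_scaledRep_isBigO P Q R model_mem).sub minor_minor).congr_left ?_)
  intro z
  simp only [map_sum, map_mul, Finset.sum_apply, Pi.mul_apply, piQ_C_apply, piQ_model_scaledRep,
    Finset.sum_mul, ← Finset.sum_add_distrib, ← Finset.sum_sub_distrib]
  exact Finset.sum_congr rfl fun s _ => Finset.sum_congr rfl fun r _ => by ring

end ScaledRepresentation

section KoszulCycles

/-- The values on basis vectors of an element of `Sym² V ⊗ Λ³ V` that the Koszul differential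
sends to zero in `Sym³ V ⊗ Λ² V`. -/
structure IsKoszulCycle {ι K : Type*} [AddCommGroup K] (D : ι → ι → ι → ι → ι → K) : Prop where
  symm : ∀ r s a b c, D r s a b c = D s r a b c
  swap₁₂ : ∀ r s a b c, D r s a b c = -D r s b a c
  swap₂₃ : ∀ r s a b c, D r s a b c = -D r s a c b
  relation : ∀ i j k b c, D i j k b c + D i k j b c + D j k i b c = 0

variable {ι K : Type*} [LinearOrder ι] [Field K] [CharZero K]

theorem eq_zero_of_alternating {f : ι → ι → ι → K} (swap₁₂ : ∀ a b c, f a b c = -f b a c)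
    (swap₂₃ : ∀ a b c, f a b c = -f a c b) (A : ι → Prop)
    (h : ∀ a b c, a < b → b < c → A a → A b → A c → f a b c = 0) (a b c : ι)
    (ha : A a) (hb : A b) (hc : A c) : f a b c = 0 := by
  have diag₁₂ (a c) : f a a c = 0 := by linear_combination (1 / 2) * swap₁₂ a a c
  have diag₂₃ (a c) : f a c c = 0 := by linear_combination (1 / 2) * swap₂₃ a c c
  have of_lt {a b : ι} (hab : a < b) (c : ι) (ha : A a) (hb : A b) (hc : A c) : f a b c = 0 := by
    rcases lt_trichotomy b c with hbc | rfl | hbc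
    · exact h a b c hab hbc ha hb hc
    · exact diag₂₃ a b
    rcases lt_trichotomy a c with hac | rfl | hac
    · rw [swap₂₃, h a c b hac hbc ha hc hb, neg_zero]
    · rw [swap₂₃, diag₁₂, neg_zero]
    · rw [swap₂₃, swap₁₂, h c a b hac hab hc ha hb, neg_zero, neg_zero]
  rcases lt_trichotomy a b with hab | rfl | hab
  · exact of_lt hab c ha hb hc
  · exact diag₁₂ a c
  · rw [swap₁₂, of_lt hab c hb ha hc, neg_zero]

namespace IsKoszulCycle

variable {D : ι → ι → ι → ι → ι → K} (hD : IsKoszulCycle D)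
  (hexcl : ∀ p q a b c, p < q → a < b → b < c → Excluded p q a b c → D p q a b c = 0)

include hD hexcl

theorem apply_self_right_eq_zero
    {a b c : ι} (hab : a < b) (hbc : b < c) (p : ι) : D p c p a b = 0 := by
  rcases lt_trichotomy p a with hpa | rfl | hap
  · exact hexcl _ _ _ _ _ (hpa.trans (hab.trans hbc)) hpa hab (by grind [Excluded])
  · linear_combination (1 / 2) * hD.swap₁₂ p c p p b
  rcases lt_trichotomy p b with hpb | rfl | hbp
  · rw [hD.swap₁₂, hexcl p c a p b (hpb.trans hbc) hap hpb (by grind [Excluded]), neg_zero]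
  · linear_combination hD.swap₁₂ p c a p p - (1 / 2) * hD.swap₂₃ p c a p p
  rcases lt_trichotomy p c with hpc | rfl | hcp
  · rw [hD.swap₁₂, hD.swap₂₃, hexcl p c a b p hpc hab hbp (by grind [Excluded]), neg_zero,
      neg_zero]
  · linear_combination (1 / 3) * hD.relation p p p a b
  · rw [hD.symm, hD.swap₁₂, hD.swap₂₃, hexcl c p a b p hcp hab hbp (by grind [Excluded]),
      neg_zero, neg_zero]

theorem apply_self_left_eq_zero
    (p a b c : ι) : D p p a b c = 0 := by
  refine eq_zero_of_alternating (hD.swap₁₂ p p) (hD.swap₂₃ p p) (fun _ => True) ?_ a b c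
    trivial trivial trivial
  intro a b c hab hbc _ _ _
  linear_combination hD.relation p p c a b + hD.swap₂₃ p p a b c - hD.swap₁₂ p p a c b
    - 2 * hD.apply_self_right_eq_zero hexcl hab hbc p

theorem eq_zero_of_mem
    {p a b c : ι} (q : ι) (hp : p = a ∨ p = b ∨ p = c) : D p q a b c = 0 := by
  have apply_self_right (p q b c : ι) : D p q p b c = 0 := by
    linear_combination (1 / 2) * hD.relation p p q b c
      - (1 / 2) * hD.apply_self_left_eq_zero hexcl p q b c
  rcases hp with rfl | rfl | rfl
  · exact apply_self_right ..
  · rw [hD.swap₁₂, apply_self_right, neg_zero]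
  · rw [hD.swap₂₃, hD.swap₁₂, apply_self_right, neg_zero, neg_zero]

theorem eq_zero_of_forall_lt
    {p q a b c : ι} (hpq : p < q) (hpa : p < a) (hpb : p < b) (hpc : p < c) :
    D p q a b c = 0 := by
  refine eq_zero_of_alternating (hD.swap₁₂ p q) (hD.swap₂₃ p q) (p < ·) ?_ a b c hpa hpb hpc
  intro a b c hab hbc hpa _ _
  by_cases hq : q = a ∨ q = b ∨ q = c
  · rw [hD.symm, hD.eq_zero_of_mem hexcl p hq]
  · simp only [not_or] at hq
    exact hexcl p q a b c hpq hab hbc (.inl ⟨hpa, hq⟩)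

theorem eq_zero_of_lt
    {p q a b c : ι} (hpq : p < q) (hab : a < b) (hbc : b < c) : D p q a b c = 0 := by
  by_cases hp : p = a ∨ p = b ∨ p = c
  · exact hD.eq_zero_of_mem hexcl q hp
  rcases lt_or_gt_of_ne (not_or.1 hp).1 with hpa | hap
  · exact hD.eq_zero_of_forall_lt hexcl hpq hpa (hpa.trans hab) (hpa.trans (hab.trans hbc))
  · -- The other two terms of the relation have the smallest index `a` in first place.
    linear_combination hD.relation a p q b c
      - hD.eq_zero_of_forall_lt hexcl hap (hap.trans hpq) hab (hab.trans hbc)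
      - hD.eq_zero_of_forall_lt hexcl (hap.trans hpq) hap hab (hab.trans hbc)

theorem eq_zero_of_excluded
    (p q a b c : ι) : D p q a b c = 0 := by
  refine eq_zero_of_alternating (hD.swap₁₂ p q) (hD.swap₂₃ p q) (fun _ => True) ?_ a b c
    trivial trivial trivial
  intro a b c hab hbc _ _ _
  rcases lt_trichotomy p q with hpq | rfl | hqp
  · exact hD.eq_zero_of_lt hexcl hpq hab hbc
  · exact hD.apply_self_left_eq_zero hexcl p a b c
  · rw [hD.symm, hD.eq_zero_of_lt hexcl hqp hab hbc]

end IsKoszulCycle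

end KoszulCycles

section Forms

variable {n : ℕ} {K : Type*}

section CommRing

variable [CommRing K]

theorem Index.sum_zero (s : Index n) : s.sum (0 : Fin n → K) = 0 := by
  cases s <;> simp [Index.sum]

theorem Index.sum_add (P P' : Fin n → K) (s : Index n) : s.sum (P + P') = s.sum P + s.sum P' := by
  rcases s with i | ⟨i, j, h⟩ | ⟨i, j, k, h, h'⟩ <;> simp only [Index.sum, Pi.add_apply] <;> ring

theorem Index.minor_add (P P' Q R : Fin n → K) (s : Index n) :
    s.minor (P + P') Q R = s.minor P Q R + s.minor P' Q R := by
  rcases s with i | ⟨i, j, h⟩ | ⟨i, j, k, h, h'⟩ <;>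
    simp only [Index.minor, triple, Pi.add_apply] <;> ring

theorem sum_mul_minor_single (c : Index n → K) {i j k : Fin n} (hij : i < j) (hjk : j < k) :
    ∑ t, c t * t.minor (Pi.single i 1) (Pi.single j 1) (Pi.single k 1) =
      c (.three i j k hij hjk) := by
  rw [Finset.sum_eq_single (.three i j k hij hjk)]
  · simp [Index.minor, triple, hij.ne', hjk.ne', (hij.trans hjk).ne']
  · rintro (_ | _ | ⟨a, b, c, h, h'⟩) - ht
    · simp only [Index.minor, mul_zero]
    · simp only [Index.minor, mul_zero]
    · simp only [ne_eq, Index.three.injEq] at ht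
      simp only [Index.minor, triple, Pi.single_apply]
      grind
  · simp

theorem sum_mul_sum_single_of_lt {c : Index n → K}
    (hc : ∀ i j k hij hjk, c (.three i j k hij hjk) = 0) {r s : Fin n} (hrs : r < s) :
    ∑ t, c t * (t.sum (Pi.single r 1) * t.sum (Pi.single s 1)) = c (.two r s hrs) := by
  rw [Finset.sum_eq_single (.two r s hrs)]
  · simp [Index.sum, hrs.ne, hrs.ne']
  · rintro (i | ⟨i, j, h⟩ | ⟨i, j, k, h, h'⟩) - ht
    · simp only [Index.sum, Pi.single_apply]
      grind
    · simp only [ne_eq, Index.two.injEq] at ht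
      simp only [Index.sum, Pi.single_apply]
      grind
    · rw [hc, zero_mul]
  · simp

theorem sum_mul_sum_single_self {c : Index n → K}
    (hc₃ : ∀ i j k hij hjk, c (.three i j k hij hjk) = 0)
    (hc₂ : ∀ i j hij, c (.two i j hij) = 0) (r : Fin n) :
    ∑ t, c t * (t.sum (Pi.single r 1) * t.sum (Pi.single r 1)) = c (.one r) := by
  rw [Finset.sum_eq_single (.one r)]
  · simp [Index.sum]
  · rintro (i | ⟨i, j, h⟩ | ⟨i, j, k, h, h'⟩) - ht
    · simp only [ne_eq, Index.one.injEq] at ht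
      simp [Index.sum, ht]
    · rw [hc₂, zero_mul]
    · rw [hc₃, zero_mul]
  · simp

theorem eq_zero_of_bilinear {c : Index n → K}
    (hc : ∀ i j k hij hjk, c (.three i j k hij hjk) = 0)
    (h : ∀ r s, ∑ t, c t * (t.sum (Pi.single r 1) * t.sum (Pi.single s 1)) = 0) (t : Index n) :
    c t = 0 := by
  have c_two_eq_zero (i j : Fin n) (hij : i < j) : c (.two i j hij) = 0 := by
    rw [← sum_mul_sum_single_of_lt hc hij, h]
  rcases t with i | ⟨i, j, hij⟩ | ⟨i, j, k, hij, hjk⟩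
  · rw [← sum_mul_sum_single_self hc c_two_eq_zero i, h]
  · exact c_two_eq_zero i j hij
  · exact hc i j k hij hjk

/-- The form with coefficients `d`, symmetric in `x`, `y` and alternating in `P`, `Q`, `R`; on basis
vectors it records the coefficients of `d` at the indices of length three. -/
noncomputable def mixedForm (d : Index n → Index n → K) (x y P Q R : Fin n → K) : K :=
  ∑ s, ∑ r, d s r * (s.sum x * s.sum y * r.minor P Q R)

variable (d : Index n → Index n → K) (x y P Q R : Fin n → K)

theorem mixedForm_symm : mixedForm d x y P Q R = mixedForm d y x P Q R := by
  simp only [mixedForm, mul_comm (Index.sum x _)]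

theorem mixedForm_swap₁₂ : mixedForm d x y P Q R = -mixedForm d x y Q P R := by
  simp only [mixedForm, Index.minor_swap₁₂ P, mul_neg, Finset.sum_neg_distrib]

theorem mixedForm_swap₂₃ : mixedForm d x y P Q R = -mixedForm d x y P R Q := by
  simp only [mixedForm, Index.minor_swap₂₃ P Q, mul_neg, Finset.sum_neg_distrib]

theorem mixedForm_single {a b c : Fin n} (hab : a < b) (hbc : b < c) :
    mixedForm d x y (Pi.single a 1) (Pi.single b 1) (Pi.single c 1) =
      ∑ t, d t (.three a b c hab hbc) * (t.sum x * t.sum y) := by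
  simp only [mixedForm, ← mul_assoc, sum_mul_minor_single _ hab hbc]

end CommRing

variable [Field K] [CharZero K]

theorem eq_zero_of_quadratic {c : Index n → K}
    (hc : ∀ i j k hij hjk, c (.three i j k hij hjk) = 0)
    (h : ∀ P : Fin n → K, ∑ t, c t * t.sum P ^ 2 = 0) (t : Index n) : c t = 0 := by
  refine eq_zero_of_bilinear hc (fun r s => ?_) t
  have polarization (x y : Fin n → K) : 2 * ∑ t, c t * (t.sum x * t.sum y) =
      ∑ t, c t * t.sum (x + y) ^ 2 - ∑ t, c t * t.sum x ^ 2 - ∑ t, c t * t.sum y ^ 2 := by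
    simp only [Finset.mul_sum, ← Finset.sum_sub_distrib, Index.sum_add]
    exact Finset.sum_congr rfl fun t _ => by ring
  simpa [h] using polarization (Pi.single r 1) (Pi.single s 1)

theorem mixedForm_self_eq_zero {d : Index n → Index n → K}
    (h : ∀ P Q R : Fin n → K, ∑ s, ∑ r, d s r * (s.quad P Q R * r.minor P Q R) = 0)
    (P Q R : Fin n → K) : mixedForm d P P P Q R = 0 := by
  have expansion (a : K) :
      ∑ s, ∑ r, d s r * (s.quad (a • P) Q R * r.minor (a • P) Q R) =
        a ^ 3 * mixedForm d P P P Q R + a * mixedForm d Q R P Q R := by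
    simp only [mixedForm, Finset.mul_sum, ← Finset.sum_add_distrib, Index.quad, Index.sum_smul,
      Index.minor_smul]
    exact Finset.sum_congr rfl fun s _ => Finset.sum_congr rfl fun r _ => by ring
  simp only [h] at expansion
  linear_combination (1 / 3) * expansion 1 - (1 / 6) * expansion 2

theorem mixedForm_relation {d : Index n → Index n → K}
    (h : ∀ P Q R : Fin n → K, ∑ s, ∑ r, d s r * (s.quad P Q R * r.minor P Q R) = 0)
    (x y z Q R : Fin n → K) :
    mixedForm d x y z Q R + mixedForm d x z y Q R + mixedForm d y z x Q R = 0 := by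
  have polarization :
      2 * (mixedForm d x y z Q R + mixedForm d x z y Q R + mixedForm d y z x Q R) =
      mixedForm d (x + y + z) (x + y + z) (x + y + z) Q R - mixedForm d (x + y) (x + y) (x + y) Q R
        - mixedForm d (x + z) (x + z) (x + z) Q R - mixedForm d (y + z) (y + z) (y + z) Q R
        + mixedForm d x x x Q R + mixedForm d y y y Q R + mixedForm d z z z Q R := by
    simp only [mixedForm, Finset.mul_sum, ← Finset.sum_add_distrib, ← Finset.sum_sub_distrib,
      Index.sum_add, Index.minor_add]
    exact Finset.sum_congr rfl fun s _ => Finset.sum_congr rfl fun r _ => by ring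
  simpa [mixedForm_self_eq_zero h] using polarization

theorem isKoszulCycle_mixedForm {d : Index n → Index n → K}
    (h : ∀ P Q R : Fin n → K, ∑ s, ∑ r, d s r * (s.quad P Q R * r.minor P Q R) = 0) :
    IsKoszulCycle fun r s a b c => mixedForm d (Pi.single r 1) (Pi.single s 1)
      (Pi.single a 1) (Pi.single b 1) (Pi.single c 1) where
  symm _ _ _ _ _ := mixedForm_symm ..
  swap₁₂ _ _ _ _ _ := mixedForm_swap₁₂ ..
  swap₂₃ _ _ _ _ _ := mixedForm_swap₂₃ ..
  relation _ _ _ _ _ := mixedForm_relation h ..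

theorem three_right_eq_zero_of_mixed {d : Index n → Index n → K}
    (hS : ∀ s r, t' s * t' r ∉ S n → d s r = 0)
    (h : ∀ P Q R : Fin n → K, ∑ s, ∑ r, d s r * (s.quad P Q R * r.minor P Q R) = 0)
    (s : Index n) {a b c : Fin n} (hab : a < b) (hbc : b < c) :
    d s (.three a b c hab hbc) = 0 := by
  have three_three (i j k : Fin n) (hij hjk) :
      d (.three i j k hij hjk) (.three a b c hab hbc) = 0 :=
    hS _ _ (t₃_mul_t₃_not_mem_S hij hjk hab hbc)
  refine eq_zero_of_bilinear (c := (d · (.three a b c hab hbc))) three_three (fun r s => ?_) s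
  rw [← mixedForm_single]
  refine (isKoszulCycle_mixedForm h).eq_zero_of_excluded ?_ r s a b c
  intro p q a b c hpq hab hbc hex
  rw [mixedForm_single _ _ _ hab hbc, sum_mul_sum_single_of_lt _ hpq]
  · exact hS _ _ (t₂_mul_t₃_not_mem_S hpq hab hbc hex)
  · exact fun i j k hij hjk => hS _ _ (t₃_mul_t₃_not_mem_S hij hjk hab hbc)

theorem sum_mul_sq_mul_sq_eq_zero {d : Index n → Index n → K} (hsymm : ∀ s r, d s r = d r s)
    (h : ∀ P Q R : Fin n → K, ∑ s, ∑ r, d s r * (s.quad P Q R * r.quad P Q R) = 0)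
    (P Q : Fin n → K) : ∑ s, ∑ r, d s r * (s.sum P ^ 2 * r.sum Q ^ 2) = 0 := by
  have swap : ∑ s, ∑ r, d s r * (s.sum Q ^ 2 * r.sum P ^ 2) =
      ∑ s, ∑ r, d s r * (s.sum P ^ 2 * r.sum Q ^ 2) := by
    rw [Finset.sum_comm]
    exact Finset.sum_congr rfl fun s _ => Finset.sum_congr rfl fun r _ => by
      rw [hsymm, mul_comm (_ ^ 2)]
  have expansion : ∑ s, ∑ r, d s r * (s.quad P Q Q * r.quad P Q Q) =
      ∑ s, ∑ r, d s r * (s.quad P 0 0 * r.quad P 0 0)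
        + ∑ s, ∑ r, d s r * (s.sum P ^ 2 * r.sum Q ^ 2)
        + ∑ s, ∑ r, d s r * (s.sum Q ^ 2 * r.sum P ^ 2)
        + ∑ s, ∑ r, d s r * (s.quad Q 0 0 * r.quad Q 0 0) := by
    simp only [← Finset.sum_add_distrib, Index.quad, Index.sum_zero]
    exact Finset.sum_congr rfl fun s _ => Finset.sum_congr rfl fun r _ => by ring
  rw [h, h, h, swap] at expansion
  linear_combination (-1 / 2) * expansion

theorem coeff_eq_zero {d : Index n → Index n → K} (hsymm : ∀ s r, d s r = d r s)
    (hS : ∀ s r, t' s * t' r ∉ S n → d s r = 0)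
    (hquad : ∀ P Q R : Fin n → K, ∑ s, ∑ r, d s r * (s.quad P Q R * r.quad P Q R) = 0)
    (hmixed : ∀ P Q R : Fin n → K, ∑ s, ∑ r, d s r * (s.quad P Q R * r.minor P Q R) = 0)
    (s r : Index n) : d s r = 0 := by
  have three_right (s : Index n) (i j k : Fin n) (hij hjk) : d s (.three i j k hij hjk) = 0 :=
    three_right_eq_zero_of_mixed hS hmixed s hij hjk
  refine eq_zero_of_quadratic (three_right s) (fun Q => ?_) r
  refine eq_zero_of_quadratic (c := fun s => ∑ r, d s r * r.sum Q ^ 2) ?_ (fun P => ?_) s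
  · exact fun i j k hij hjk => Finset.sum_eq_zero fun r _ => by rw [hsymm, three_right, zero_mul]
  · rw [← sum_mul_sq_mul_sq_eq_zero hsymm hquad P Q]
    refine Finset.sum_congr rfl fun s _ => ?_
    rw [Finset.sum_mul]
    exact Finset.sum_congr rfl fun r _ => by ring

end Forms

section Bases

open Submodule

variable {n : ℕ}

theorem linear_coeff_eq_zero {c : Index n → ℚ}
    (h : ∑ s, c s • t' s ∈ J₀ n ^ 2 ⊔ IQ FreeGroup.of) (s : Index n) : c s = 0 := by
  have three_eq_zero (i j k : Fin n) (hij hjk) : (c (.three i j k hij hjk) : ℂ) = 0 := by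
    rw [← sum_mul_minor_single (fun s => (c s : ℂ)) hij hjk]
    exact (leading_forms_eq_zero_of_linear _ _ _ h).2
  refine Rat.cast_eq_zero.1
    (eq_zero_of_quadratic (c := fun s => (c s : ℂ)) three_eq_zero (fun P => ?_) s)
  simpa [Index.quad, Index.sum_zero] using (leading_forms_eq_zero_of_linear P 0 0 h).1

theorem quadratic_coeff_eq_zero {c : Index n → Index n → ℚ} (hsymm : ∀ s r, c s r = c r s)
    (hS : ∀ s r, t' s * t' r ∉ S n → c s r = 0)
    (h : ∑ s, ∑ r, c s r • (t' s * t' r) ∈ J₀ n ^ 3 ⊔ IQ FreeGroup.of) (s r : Index n) :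
    c s r = 0 := by
  have leading (P Q R : Fin n → ℂ) := leading_forms_eq_zero_of_quadratic P Q R h
  refine Rat.cast_eq_zero.1 (coeff_eq_zero (d := fun s r => (c s r : ℂ))
    (fun s r => congrArg _ (hsymm s r)) (fun s r hsr => by rw [hS s r hsr, Rat.cast_zero])
    (fun P Q R => (leading P Q R).1) (fun P Q R => ?_) s r)
  have swap : ∑ s, ∑ r, (c s r : ℂ) * (s.minor P Q R * r.quad P Q R) =
      ∑ s, ∑ r, (c s r : ℂ) * (s.quad P Q R * r.minor P Q R) := by
    rw [Finset.sum_comm]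
    exact Finset.sum_congr rfl fun s _ => Finset.sum_congr rfl fun r _ => by
      rw [hsymm, mul_comm (Index.minor _ _ _ _)]
  have mixed := (leading P Q R).2
  simp only [mul_add, Finset.sum_add_distrib, swap] at mixed
  exact add_self_eq_zero.1 mixed

theorem disjoint_span_T :
    Disjoint (span ℚ (T n)) ((J₀ n ^ 2 ⊔ IQ FreeGroup.of).restrictScalars ℚ) := by
  rw [disjoint_def, T_eq_range]
  intro p hp hp'
  obtain ⟨c, rfl⟩ := (mem_span_range_iff_exists_fun ℚ).1 hp
  exact Finset.sum_eq_zero fun s _ => by rw [linear_coeff_eq_zero hp' s, zero_smul]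

theorem exists_symm_coeff_of_mem_span_S {p : Poly n} (hp : p ∈ span ℚ (S n)) :
    ∃ c : Index n → Index n → ℚ, (∀ s r, c s r = c r s) ∧
      (∀ s r, t' s * t' r ∉ S n → c s r = 0) ∧ ∑ s, ∑ r, c s r • (t' s * t' r) = p := by
  classical
  induction hp using span_induction with
  | mem p hp =>
    obtain ⟨a, b, rfl⟩ := exists_of_mem_S hp
    refine ⟨fun s r => (if s = a ∧ r = b then 1 / 2 else 0) + if s = b ∧ r = a then 1 / 2 else 0,
      fun s r => by grind, fun s r hsr => ?_, ?_⟩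
    · have ne_left : ¬(s = a ∧ r = b) := by
        rintro ⟨rfl, rfl⟩
        exact hsr hp
      have ne_right : ¬(s = b ∧ r = a) := by
        rintro ⟨rfl, rfl⟩
        exact hsr (mul_comm (t' r) _ ▸ hp)
      simp only [if_neg ne_left, if_neg ne_right, add_zero]
    · simp only [add_smul, ite_smul, zero_smul, ite_and, Finset.sum_add_distrib]
      simp only [Finset.sum_ite_eq', Finset.sum_ite_irrel, Finset.sum_const_zero, Finset.mem_univ,
        if_true, mul_comm (t' b), ← add_smul]
      norm_num
  | zero => exact ⟨0, by simp, by simp, by simp⟩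
  | add p q _ _ hp hq =>
    obtain ⟨c, hc, hcS, rfl⟩ := hp
    obtain ⟨d, hd, hdS, rfl⟩ := hq
    exact ⟨c + d, fun s r => congrArg₂ (· + ·) (hc s r) (hd s r),
      fun s r hsr => by simp [hcS s r hsr, hdS s r hsr],
      by simp only [Pi.add_apply, add_smul, Finset.sum_add_distrib]⟩
  | smul a p _ hp =>
    obtain ⟨c, hc, hcS, rfl⟩ := hp
    exact ⟨a • c, fun s r => congrArg (a * ·) (hc s r), fun s r hsr => by simp [hcS s r hsr],
      by simp only [Pi.smul_apply, smul_assoc, Finset.smul_sum]⟩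

theorem disjoint_span_S :
    Disjoint (span ℚ (S n)) ((J₀ n ^ 3 ⊔ IQ FreeGroup.of).restrictScalars ℚ) := by
  rw [disjoint_def]
  intro p hp hp'
  obtain ⟨c, hsymm, hS, rfl⟩ := exists_symm_coeff_of_mem_span_S hp
  exact Finset.sum_eq_zero fun s _ => Finset.sum_eq_zero fun r _ => by
    rw [quadratic_coeff_eq_zero hsymm hS hp' s r, zero_smul]

theorem IQ_le_J₀_sq : IQ (FreeGroup.of : Fin n → FreeGroup (Fin n)) ≤ J₀ n ^ 2 := by
  intro p hp
  obtain ⟨y, hy, z, hz, rfl⟩ := mem_sup.1 (mem_span_rat_sup_J₀_mul (IQ_le_J₀ _ hp))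
  have hz : z ∈ J₀ n ^ 2 := (pow_two (J₀ n)).symm ▸ hz
  have y_mem : y ∈ J₀ n ^ 2 ⊔ IQ FreeGroup.of := by
    rw [← add_sub_cancel_right y z]
    exact sub_mem (Ideal.mem_sup_right hp) (Ideal.mem_sup_left hz)
  rwa [disjoint_def.1 disjoint_span_T y hy y_mem, zero_add]

theorem isGrBasis_T : IsGrBasis (FreeGroup.of : Fin n → FreeGroup (Fin n)) 1 (T n) := by
  refine isGrBasis_of_disjoint ?_ ?_ linearIndepOn_T disjoint_span_T
  · intro p hp
    rw [pow_one]
    exact Ideal.subset_span hp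
  · intro p hp
    rw [pow_one] at hp
    obtain ⟨y, hy, z, hz, rfl⟩ := mem_sup.1 (mem_span_rat_sup_J₀_mul hp)
    exact add_mem_sup hy (Ideal.mem_sup_left ((pow_two (J₀ n)).symm ▸ hz))

theorem isGrBasis_S : IsGrBasis (FreeGroup.of : Fin n → FreeGroup (Fin n)) 2 (S n) := by
  refine isGrBasis_of_disjoint ?_ (fun p hp => J₀_sq_le_spanS hp) linearIndepOn_S disjoint_span_S
  intro p hp
  obtain ⟨s, r, rfl⟩ := exists_of_mem_S hp
  exact t'_mul_t'_mem_J₀_sq s r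

end Bases

end Fricke

theorem mainTheorem1 (n : ℕ) (hn : 2 ≤ n) :
    Fricke.IQ (FreeGroup.of : Fin n → FreeGroup (Fin n)) ≤ Fricke.J₀ n ^ 2 ∧
    Fricke.IsGrBasis (FreeGroup.of : Fin n → FreeGroup (Fin n)) 1 (Fricke.T n) ∧
    Fricke.IsGrBasis (FreeGroup.of : Fin n → FreeGroup (Fin n)) 2 (Fricke.S n) :=
  ⟨Fricke.IQ_le_J₀_sq, Fricke.isGrBasis_T, Fricke.isGrBasis_S⟩
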